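/- Setting. Let $r\ge 1$, $q=\tfrac12 r(r+3)$. A cluster parameter is $\theta=(\mu,\Psi)$ with $\mu\in\mathbb R^r$ and $\Psi$ a symmetric positive definite $r\times r$ matrix, identified with the vector $(\mu,u)\in\mathbb R^q$, where $u$ lists the unique entries of $\Psi$, $\mathrm{vec}(\Psi)=Du$ with $D$ the duplication matrix. For $\nu>0$ let $t_\nu(x;\theta)$ be the $r$-variate $t_\nu$ density $$\frac{\Gamma((\nu+r)/2)}{\Gamma(\nu/2)(\pi\nu)^{r/2}}|\Psi|^{-1/2}\Bigl(1+\frac{\delta}{\nu}\Bigr)^{-(\nu+r)/2},\qquad \delta=(x-\mu)^\top\Psi^{-1}(x-\mu).$$ Candidate models $M_l$, $l=L_{\min},\dots,L_{\max}$ ($1\le L_{\min}\le L_{\max}$), have prior probabilities $p(M_l)>0$ summing to $1$, fixed degrees of freedom $\nu_m>0$ ($m=1,\dots,l$), a parameter space $\Omega_l\subset\mathbb R^{q\times l}$ (all scatter matrices positive definite) and a prior density $f(\Theta_l|M_l)$ on $\Omega_l$, continuous in the interior of $\Omega_l$; none of these depends on the data or on $N$. For a data set $\mathcal X=\{x_1,\dots,x_N\}\subset\mathbb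 R^r$ each model comes with a partition into $l$ non-empty clusters $\mathcal X_m$ of sizes $N_m$ and an estimate $\hat\Theta_l=(\hat\theta_1,\dots,\hat\theta_l)$. The likelihood is $\mathcal L(\Theta_l|\mathcal X)=\prod_m\mathcal L(\theta_m|\mathcal X_m)$, $\mathcal L(\theta_m|\mathcal X_m)=\prod_{x_n\in\mathcal X_m}\frac{N_m}{N}t_{\nu_m}(x_n;\theta_m)$; the posterior is $p(M_l|\mathcal X)=p(M_l)\int_{\Omega_l}f(\Theta|M_l)\mathcal L(\Theta|\mathcal X)\,d\Theta/f(\mathcal X)$, where $f(\mathcal X)$ is the sum of these numerators over all candidate models; and $\hat J_m=-\frac{d^2\log\mathcal L(\theta_m|\mathcal X_m)}{d\theta_m d\theta_m^\top}\big|_{\hat\theta_m}$. Put $$\mathrm{BIC}_{Ft_\nu}(M_l)=\log\mathcal L(\hat\Theta_l|\mathcal X)-\tfrac12\sum_{m=1}^l\log|\hat J_m| .$$ (a) Finite sample size. Let $N$ be arbitrary and let $\hat\Theta_l$ be an interior point of $\Omega_l$ at which $\log\mathcal L(\cdot|\mathcal X)$ attains its maximum over $\Omega_l$. With $\tilde x_n=x_n-\hat\mu_m$,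 $w_n=(\nu_m+r)/(\nu_m+\delta_n)$ and $\delta_n=\tilde x_n^\top\hat\Psi_m^{-1}\tilde x_n$, $$\hat J_m=\begin{bmatrix}-\hat J_{\mu\mu^\top}&-\hat J_{\mu\Psi}\\-\hat J_{\mu\Psi}^\top&-\hat J_{\Psi\Psi}\end{bmatrix},$$ $$\hat J_{\mu\mu^\top}=\tfrac{2}{\nu_m+r}\hat\Psi_m^{-1}\Bigl(\sum_{x_n\in\mathcal X_m} w_n^2\tilde x_n\tilde x_n^\top\Bigr)\hat\Psi_m^{-1}-\hat\Psi_m^{-1}\sum_{x_n\in\mathcal X_m} w_n,$$ $$\hat J_{\mu\Psi}=\tfrac1{\nu_m+r}\sum_{x_n\in\mathcal X_m} w_n^2\bigl(\hat\Psi_m^{-1}\tilde x_n\tilde x_n^\top\hat\Psi_m^{-1}\otimes\tilde x_n^\top\hat\Psi_m^{-1}\bigr)D,$$ $$\hat J_{\Psi\Psi}=-\tfrac{N_m}2D^\top(\hat\Psi_m^{-1}\otimes\hat\Psi_m^{-1})D+\tfrac1{2(\nu_m+r)}D^\top(\hat\Psi_m^{-1}\otimes\hat\Psi_m^{-1})\sum_{x_n\in\mathcal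 X_m} w_n^2(\tilde x_n\tilde x_n^\top\otimes\tilde x_n\tilde x_n^\top)(\hat\Psi_m^{-1}\otimes\hat\Psi_m^{-1})D;$$ $\hat J_{\Psi\Psi}$ is invertible and $$|\hat J_m|=\bigl|-\hat J_{\mu\mu^\top}+\hat J_{\mu\Psi}\hat J_{\Psi\Psi}^{-1}\hat J_{\mu\Psi}^\top\bigr|\;\bigl|-\hat J_{\Psi\Psi}\bigr| .$$ Moreover $$\log\mathcal L(\hat\Theta_l|\mathcal X)=\sum_m N_m\log N_m-\sum_m\tfrac{N_m}2\log|\hat\Psi_m|+\sum_m N_m\log\tfrac{\Gamma((\nu_m+r)/2)}{\Gamma(\nu_m/2)(\pi\nu_m)^{r/2}}-\tfrac12\sum_m\sum_{x_n\in\mathcal X_m}(\nu_m+r)\log\bigl(1+\tfrac{\delta_n}{\nu_m}\bigr)-N\log N,$$ so $\mathrm{BIC}_{Ft_\nu}(M_l)$ is an explicit expression (the term $-N\log N$ does not depend on the model). If in addition all $\hat J_m$ are positive definite, $f(\hat\Theta_l|M_l)>0$ and $f(\mathcal X)>0$, then the Laplace approximation of $p(M_l|\mathcal X)$, in which the prior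 density is replaced by its value at $\hat\Theta_l$ and $\log\mathcal L$ by its second-order Taylor polynomial at $\hat\Theta_l$ (and one integrates over $\mathbb R^{q\times l}$), is positive and its logarithm equals exactly $$E_l=\log p(M_l)+\log f(\hat\Theta_l|M_l)+\mathrm{BIC}_{Ft_\nu}(M_l)+\tfrac{lq}2\log 2\pi-\log f(\mathcal X).$$ (b) Accuracy. For each $N$ let a data set of size $N$ with partitions and estimates be given such that, for every $l$ and as $N\to\infty$: (i) eventually all clusters are non-empty, and $\log N=o(N_m)$ for every $m$; (ii) eventually $\hat\Theta_l$ is an interior global maximum point of the likelihood over $\Omega_l$, and these points eventually stay in a compact subset of the interior of $\Omega_l$ on which the prior density is positive; (iii) the maxima are well separated: for every $d>0$ there is $\kappa>0$ such that for all large $N$, $\log\mathcal L(\Theta|\mathcal X)\le\log\mathcal L(\hat\Theta_l|\mathcal X)-\kappa N_m$ for all $\Theta\in\Omega_l$ and $m$ with $\|\theta_m-\hat\theta_m\|\ge d$; (iv) for some $e>0$ and all large $N$ the eigenvalues of all $\frac1{N_m}\hat J_m$ are at least $e$. Then, for every $l$, $p(M_l|\mathcal X)>0$ for all large $N$, and $$\log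 p(M_l|\mathcal X)-E_l\to0,\qquad \log p(M_l|\mathcal X)=\mathrm{BIC}_{Ft_\nu}(M_l)-\log f(\mathcal X)+O(1)\quad(N\to\infty),$$ where $f(\mathcal X)$ does not depend on the model. -/

import Mathlib

open MeasureTheory Filter Topology Asymptotics
open scoped Matrix Kronecker

noncomputable section

/-! ### Parameters of one cluster -/

/-- Coordinates of a cluster parameter: the `r` entries of the location vector and one entry for
each unordered pair of indices, i.e. the `r (r + 1) / 2` unique entries of a symmetric matrix. -/
abbrev ParIdx (r : ℕ) : Type := Fin r ⊕ Sym2 (Fin r)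

/-- The space `ℝ^q`, `q = r (r + 3) / 2`, in which a cluster parameter `θ = (μ, u)` lives. -/
abbrev Par (r : ℕ) : Type := ParIdx r → ℝ

/-- The number `q` of parameters per cluster. -/
def numPar (r : ℕ) : ℝ := (r : ℝ) * (r + 3) / 2

/-- The location vector `μ` of `θ`. -/
def loc {r : ℕ} (θ : Par r) : Fin r → ℝ := fun i => θ (Sum.inl i)

/-- The symmetric scatter matrix `Ψ` whose unique entries are the remaining coordinates of `θ`. -/
def scat {r : ℕ} (θ : Par r) : Matrix (Fin r) (Fin r) ℝ :=
  Matrix.of fun i j => θ (Sum.inr s(i, j))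

/-- The duplication matrix `D`, `vec Ψ = D u`. -/
def dupMat (r : ℕ) : Matrix (Fin r × Fin r) (Sym2 (Fin r)) ℝ :=
  Matrix.of fun p s => if s(p.1, p.2) = s then 1 else 0

theorem vec_scat {r : ℕ} (θ : Par r) :
    (scat θ).vec = dupMat r *ᵥ (fun s => θ (Sum.inr s)) := by
  ext ⟨i, j⟩
  simp [scat, dupMat, Matrix.vec, Matrix.mulVec, dotProduct, Sym2.eq_swap]

/-! ### The multivariate `t_ν` distribution -/

/-- Centred data vector `x - μ`. -/
def centred {r : ℕ} (θ : Par r) (x : Fin r → ℝ) : Fin r → ℝ := x - loc θ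

/-- Squared Mahalanobis distance `δ = (x - μ)ᵀ Ψ⁻¹ (x - μ)`. -/
def mahal {r : ℕ} (θ : Par r) (x : Fin r → ℝ) : ℝ :=
  centred θ x ⬝ᵥ ((scat θ)⁻¹ *ᵥ centred θ x)

/-- Normalizing factor `Γ((ν + r)/2) / (Γ(ν/2) (π ν)^(r/2))`. -/
def tNorm (r : ℕ) (ν : ℝ) : ℝ :=
  Real.Gamma ((ν + r) / 2) / (Real.Gamma (ν / 2) * (Real.pi * ν) ^ ((r : ℝ) / 2))

/-- Density of the `r`-variate `t_ν` distribution with parameter `θ = (μ, Ψ)`. -/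
def tPdf {r : ℕ} (ν : ℝ) (θ : Par r) (x : Fin r → ℝ) : ℝ :=
  tNorm r ν * (scat θ).det ^ (-(1 / 2) : ℝ) * (1 + mahal θ x / ν) ^ (-((ν + r) / 2))

/-- The weight `w = (ν + r) / (ν + δ)` of a data vector. -/
def weight {r : ℕ} (ν : ℝ) (θ : Par r) (x : Fin r → ℝ) : ℝ := (ν + r) / (ν + mahal θ x)

/-! ### Candidate models, prior distributions and clustered data -/

/-- A family of candidate models `M_l`, `l = Lmin, …, Lmax`, for data in `ℝ^r`. None of its
components depends on the data or on their number. -/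
structure ModelFamily (r : ℕ) where
  /-- smallest number of clusters -/
  Lmin : ℕ
  /-- largest number of clusters -/
  Lmax : ℕ
  one_le_Lmin : 1 ≤ Lmin
  Lmin_le_Lmax : Lmin ≤ Lmax
  /-- the discrete prior `p(M_l)` -/
  p : Finset.Icc Lmin Lmax → ℝ
  p_pos : ∀ l, 0 < p l
  p_sum : ∑ l, p l = 1
  /-- the prespecified degrees of freedom `ν_m` of the clusters -/
  ν : ∀ l : Finset.Icc Lmin Lmax, Fin l.1 → ℝ
  ν_pos : ∀ l m, 0 < ν l m
  /-- the parameter space `Ω_l` -/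
  Ω : ∀ l : Finset.Icc Lmin Lmax, Set (Fin l.1 → Par r)
  Ω_meas : ∀ l, MeasurableSet (Ω l)
  Ω_posDef : ∀ l, ∀ Θ ∈ Ω l, ∀ m, (scat (Θ m)).PosDef
  /-- the prior density `f(Θ_l | M_l)` on `Ω_l` -/
  f : ∀ l : Finset.Icc Lmin Lmax, (Fin l.1 → Par r) → ℝ
  f_nonneg : ∀ l, ∀ Θ ∈ Ω l, 0 ≤ f l Θ
  f_int : ∀ l, IntegrableOn (f l) (Ω l)
  f_one : ∀ l, ∫ Θ in Ω l, f l Θ = 1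
  f_cont : ∀ l, ContinuousOn (f l) (interior (Ω l))

/-- The number of clusters of a candidate model. -/
abbrev ModelFamily.Idx {r : ℕ} (M : ModelFamily r) : Type := Finset.Icc M.Lmin M.Lmax

/-- A data set of size `N` and the output of a clustering algorithm: for each candidate model a
partition into `l` clusters (given by labels) and parameter estimates. -/
structure ClusteredData {r : ℕ} (M : ModelFamily r) (N : ℕ) where
  /-- the data vectors -/
  x : Fin N → Fin r → ℝ
  /-- the label of each data vector in model `M_l` -/
  label : ∀ l : M.Idx, Fin N → Fin l.1
  /-- the estimate of the cluster parameter matrix `Θ_l` -/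
  est : ∀ l : M.Idx, Fin l.1 → Par r

namespace ClusteredData

variable {r : ℕ} {M : ModelFamily r} {N : ℕ} (S : ClusteredData M N) (l : M.Idx)

/-- Indices of the data vectors in the `m`-th cluster `X_m`. -/
def cluster (m : Fin l.1) : Finset (Fin N) := Finset.univ.filter fun n => S.label l n = m

/-- Cluster size `N_m`. -/
def size (m : Fin l.1) : ℕ := (S.cluster l m).card

/-- `L(θ_m | X_m) = ∏_{x_n ∈ X_m} p(x_n ∈ X_m) f(x_n | θ_m)` with `p(x_n ∈ X_m) = N_m / N`. -/
def clusterLik (m : Fin l.1) (θ : Par r) : ℝ :=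
  ∏ n ∈ S.cluster l m, ((S.size l m : ℝ) / N) * tPdf (M.ν l m) θ (S.x n)

/-- The likelihood function `L(Θ_l | X)`. -/
def lik (Θ : Fin l.1 → Par r) : ℝ := ∏ m, S.clusterLik l m (Θ m)

/-- The log-likelihood function. -/
def logLik (Θ : Fin l.1 → Par r) : ℝ := Real.log (S.lik l Θ)

/-- The estimate is a global maximum of the likelihood over `Ω_l` and interior to `Ω_l`. -/
def IsMLE : Prop := S.est l ∈ interior (M.Ω l) ∧ IsMaxOn (S.logLik l) (M.Ω l) (S.est l)

/-- The integral of prior times likelihood, `f(X | M_l)`. -/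
def evidence : ℝ := ∫ Θ in M.Ω l, M.f l Θ * S.lik l Θ

/-- The density `f(X)` of the data set, by the law of total probability. -/
def marginal : ℝ := ∑ k : M.Idx, M.p k * S.evidence k

/-- The posterior probability `p(M_l | X)`, by Bayes' theorem. -/
def posterior : ℝ := M.p l * S.evidence l / S.marginal

end ClusteredData

/-! ### Fisher information matrix and criterion -/

/-- The matrix of second partial derivatives. -/
def hessian {ι : Type*} [Fintype ι] [DecidableEq ι] (g : (ι → ℝ) → ℝ) (a : ι → ℝ) :
    Matrix ι ι ℝ :=
  Matrix.of fun i j => fderiv ℝ (fderiv ℝ g) a (Pi.single i 1) (Pi.single j 1)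

/-- The second-order Taylor polynomial of `g` at `a`. -/
def taylorTwo {E : Type*} [NormedAddCommGroup E] [NormedSpace ℝ E] (g : E → ℝ) (a y : E) : ℝ :=
  g a + fderiv ℝ g a (y - a) + 1 / 2 * fderiv ℝ (fderiv ℝ g) a (y - a) (y - a)

namespace ClusteredData

variable {r : ℕ} {M : ModelFamily r} {N : ℕ} (S : ClusteredData M N) (l : M.Idx)

/-- The Fisher information matrix `Ĵ_m`. -/
def fim (m : Fin l.1) : Matrix (ParIdx r) (ParIdx r) ℝ :=
  -hessian (fun θ => Real.log (S.clusterLik l m θ)) (S.est l m)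

/-- The criterion `log L(Θ̂_l | X) - (1/2) ∑_m log |Ĵ_m|`. -/
def bicF : ℝ := S.logLik l (S.est l) - 1 / 2 * ∑ m, Real.log (S.fim l m).det

/-- The explicit data fidelity term, without the model independent term `-N log N`. -/
def fidelity : ℝ :=
  ∑ m, (S.size l m : ℝ) * Real.log (S.size l m)
    - ∑ m, (S.size l m : ℝ) / 2 * Real.log (scat (S.est l m)).det
    + ∑ m, (S.size l m : ℝ) * Real.log (tNorm r (M.ν l m))
    - 1 / 2 * ∑ m, ∑ n ∈ S.cluster l m,
        (M.ν l m + r) * Real.log (1 + mahal (S.est l m) (S.x n) / M.ν l m)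

/-- Inverse `Ψ̂_m⁻¹` of the estimated scatter matrix. -/
def prec (m : Fin l.1) : Matrix (Fin r) (Fin r) ℝ := (scat (S.est l m))⁻¹

/-- `w_n` at the estimate. -/
def w (m : Fin l.1) (n : Fin N) : ℝ := weight (M.ν l m) (S.est l m) (S.x n)

/-- `x̃_n = x_n - μ̂_m`. -/
def xt (m : Fin l.1) (n : Fin N) : Fin r → ℝ := centred (S.est l m) (S.x n)

/-- The outer product `x̃_n x̃_nᵀ`. -/
def outer (m : Fin l.1) (n : Fin N) : Matrix (Fin r) (Fin r) ℝ :=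
  Matrix.vecMulVec (S.xt l m n) (S.xt l m n)

/-- The block `Ĵ_{μμᵀ}`. -/
def Jmm (m : Fin l.1) : Matrix (Fin r) (Fin r) ℝ :=
  (2 / (M.ν l m + r)) •
      (S.prec l m * (∑ n ∈ S.cluster l m, S.w l m n ^ 2 • S.outer l m n) * S.prec l m)
    - (∑ n ∈ S.cluster l m, S.w l m n) • S.prec l m

/-- The block `Ĵ_{μΨ}`; the row vector `x̃_nᵀ Ψ̂_m⁻¹` is a matrix with rows indexed by `Unit`. -/
def JmP (m : Fin l.1) : Matrix (Fin r) (Sym2 (Fin r)) ℝ :=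
  (1 / (M.ν l m + r)) • ∑ n ∈ S.cluster l m, S.w l m n ^ 2 •
    (((S.prec l m * S.outer l m n * S.prec l m) ⊗ₖ
        (Matrix.replicateRow Unit (S.xt l m n) * S.prec l m)).submatrix (fun i => (i, ())) id
      * dupMat r)

/-- The block `Ĵ_{ΨΨ}`. -/
def JPP (m : Fin l.1) : Matrix (Sym2 (Fin r)) (Sym2 (Fin r)) ℝ :=
  -(((S.size l m : ℝ) / 2) • ((dupMat r)ᵀ * (S.prec l m ⊗ₖ S.prec l m) * dupMat r))
    + (1 / (2 * (M.ν l m + r))) • ((dupMat r)ᵀ * (S.prec l m ⊗ₖ S.prec l m)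
        * (∑ n ∈ S.cluster l m, S.w l m n ^ 2 • (S.outer l m n ⊗ₖ S.outer l m n))
        * (S.prec l m ⊗ₖ S.prec l m) * dupMat r)

/-- The Schur complement expression of the determinant of `Ĵ_m` in terms of its blocks. -/
def schurDet (m : Fin l.1) : ℝ :=
  (-S.Jmm l m + S.JmP l m * (S.JPP l m)⁻¹ * (S.JmP l m)ᵀ).det * (-S.JPP l m).det

/-- Laplace's approximation of `f(X | M_l)`: the prior is replaced by its value at the estimate
and the log-likelihood by its second-order Taylor polynomial there. -/
def laplaceEvidence : ℝ :=
  ∫ Θ : Fin l.1 → Par r, M.f l (S.est l) * Real.exp (taylorTwo (S.logLik l) (S.est l) Θ)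

/-- Laplace's approximation of `p(M_l | X)`. -/
def laplacePosterior : ℝ := M.p l * S.laplaceEvidence l / S.marginal

/-- The log-posterior expansion with all terms:
`log p(M_l) + log f(Θ̂_l|M_l) + log L(Θ̂_l|X) + (lq/2) log 2π - (1/2) ∑_m log|Ĵ_m| - log f(X)`. -/
def logPosteriorExpansion : ℝ :=
  Real.log (M.p l) + Real.log (M.f l (S.est l)) + S.logLik l (S.est l)
    + (l.1 : ℝ) * numPar r / 2 * Real.log (2 * Real.pi)
    - 1 / 2 * ∑ m, Real.log (S.fim l m).det - Real.log S.marginal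

end ClusteredData

/-- The regularity assumptions for a sequence of clustered data sets, indexed by the data size. -/
structure RegularSeq {r : ℕ} (M : ModelFamily r) (S : ∀ N : ℕ, ClusteredData M N) : Prop where
  /-- clusters are not empty -/
  nonempty : ∀ l, ∀ᶠ N in atTop, Function.Surjective ((S N).label l)
  /-- every cluster grows faster than the logarithm of the data size -/
  growth : ∀ l m, (fun N : ℕ => Real.log N) =o[atTop] fun N : ℕ => ((S N).size l m : ℝ)
  /-- the estimates are interior global maxima of the likelihood -/
  isMLE : ∀ l, ∀ᶠ N in atTop, (S N).IsMLE l
  /-- they stay away from the boundary of the parameter space and from the zeros of the prior -/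
  compact : ∀ l, ∃ K : Set (Fin l.1 → Par r), IsCompact K ∧ K ⊆ interior (M.Ω l) ∧
    (∀ Θ ∈ K, 0 < M.f l Θ) ∧ ∀ᶠ N in atTop, (S N).est l ∈ K
  /-- the global maxima are well separated -/
  separated : ∀ l, ∀ d > 0, ∃ κ > 0, ∀ᶠ N in atTop, ∀ Θ ∈ M.Ω l, ∀ m,
    d ≤ ‖Θ m - (S N).est l m‖ →
      (S N).logLik l Θ ≤ (S N).logLik l ((S N).est l) - κ * (S N).size l m
  /-- the eigenvalues of the normalized Fisher information matrices are bounded away from zero -/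
  eigenvalues : ∀ l, ∃ e > 0, ∀ᶠ N in atTop, ∀ m,
    (((S N).size l m : ℝ)⁻¹ • (S N).fim l m - (e : ℝ) • 1).PosSemidef

end

noncomputable section

/-! ### Calculus of matrix valued maps -/

section MatrixCalculus

variable {n : Type*} [Fintype n]

theorem hasDerivAt_mulVec {A : ℝ → Matrix n n ℝ} {A' : Matrix n n ℝ} {x : ℝ → n → ℝ} {x' : n → ℝ}
    {t : ℝ} (hA : ∀ i j, HasDerivAt (fun s => A s i j) (A' i j) t) (hx : HasDerivAt x x' t) :
    HasDerivAt (fun s => A s *ᵥ x s) (A' *ᵥ x t + A t *ᵥ x') t := by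
  rw [hasDerivAt_pi] at hx ⊢
  intro i
  have := HasDerivAt.fun_sum (u := Finset.univ) fun j _ => (hA i j).mul (hx j)
  simpa [Matrix.mulVec, dotProduct, Finset.sum_add_distrib] using this

theorem hasDerivAt_dotProduct {x y : ℝ → n → ℝ} {x' y' : n → ℝ} {t : ℝ}
    (hx : HasDerivAt x x' t) (hy : HasDerivAt y y' t) :
    HasDerivAt (fun s => x s ⬝ᵥ y s) (x' ⬝ᵥ y t + x t ⬝ᵥ y') t := by
  rw [hasDerivAt_pi] at hx hy
  have := HasDerivAt.fun_sum (u := Finset.univ) fun j _ => (hx j).mul (hy j)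
  simpa [dotProduct, Finset.sum_add_distrib] using this

theorem hasDerivAt_trace {A : ℝ → Matrix n n ℝ} {A' : Matrix n n ℝ} {t : ℝ}
    (hA : ∀ i j, HasDerivAt (fun s => A s i j) (A' i j) t) :
    HasDerivAt (fun s => (A s).trace) A'.trace t :=
  HasDerivAt.fun_sum fun i _ => hA i i

variable [DecidableEq n]

theorem hasDerivAt_det_add_smul {A V : Matrix n n ℝ} (hA : IsUnit A.det) :
    HasDerivAt (fun t : ℝ => (A + t • V).det) (A.det * (A⁻¹ * V).trace) 0 := by
  have h (t : ℝ) : (A + t • V).det = A.det * (1 + t • (A⁻¹ * V)).det := by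
    rw [← Matrix.det_mul, Matrix.mul_add, Matrix.mul_smul, Matrix.mul_nonsing_inv_cancel_left _ _ hA,
      Matrix.mul_one]
  simp_rw [h]
  refine HasDerivAt.const_mul _ ?_
  simp only [fun t : ℝ => Matrix.det_one_add_smul t (A⁻¹ * V)]
  set p := Polynomial.divX (Polynomial.divX (Matrix.det (1 + (Polynomial.X : Polynomial ℝ) •
    (A⁻¹ * V).map Polynomial.C)))
  have h1 : HasDerivAt (fun t : ℝ => 1 + (A⁻¹ * V).trace * t) (A⁻¹ * V).trace 0 := by
    simpa using ((hasDerivAt_id (0 : ℝ)).const_mul (A⁻¹ * V).trace).const_add 1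
  have h2 := (p.hasDerivAt (0 : ℝ)).fun_mul ((hasDerivAt_id (0 : ℝ)).fun_pow 2)
  simpa using h1.fun_add h2

theorem contDiffAt_det {k : ℕ∞}
    {E : Type*} [NormedAddCommGroup E] [NormedSpace ℝ E] {F : E → Matrix n n ℝ} {a : E}
    (hF : ∀ i j, ContDiffAt ℝ k (fun x => F x i j) a) :
    ContDiffAt ℝ k (fun x => (F x).det) a := by
  simp_rw [Matrix.det_apply']
  exact ContDiffAt.sum fun σ _ => contDiffAt_const.mul (contDiffAt_prod fun i _ => hF _ _)

theorem contDiffAt_inv_apply {k : ℕ∞}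
    {E : Type*} [NormedAddCommGroup E] [NormedSpace ℝ E] {F : E → Matrix n n ℝ} {a : E}
    (hF : ∀ i j, ContDiffAt ℝ k (fun x => F x i j) a) (ha : IsUnit (F a).det) (i j : n) :
    ContDiffAt ℝ k (fun x => (F x)⁻¹ i j) a := by
  simp only [Matrix.inv_def, Matrix.smul_apply, Ring.inverse_eq_inv', Matrix.adjugate_apply,
    smul_eq_mul]
  refine ((contDiffAt_det hF).inv ha.ne_zero).mul (contDiffAt_det fun p q => ?_)
  rcases eq_or_ne p j with rfl | h
  · simpa using contDiffAt_const
  · simpa [Matrix.updateRow_ne h] using hF p q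

theorem hasDerivAt_inv_add_smul {A V : Matrix n n ℝ} (hA : IsUnit A.det) (i j : n) :
    HasDerivAt (fun t : ℝ => (A + t • V)⁻¹ i j) ((-(A⁻¹ * V * A⁻¹)) i j) 0 := by
  have hV (i j : n) : HasDerivAt (fun t : ℝ => (A + t • V) i j) (V i j) 0 := by
    simpa using ((hasDerivAt_id (0 : ℝ)).mul_const (V i j)).const_add (A i j)
  have hV' (i j : n) : ContDiffAt ℝ ((1 : ℕ∞) : WithTop ℕ∞) (fun t : ℝ => (A + t • V) i j) 0 := by
    simp only [Matrix.add_apply, Matrix.smul_apply, smul_eq_mul]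
    fun_prop
  have hd := contDiffAt_inv_apply hV' (by simpa using hA)
  set B : Matrix n n ℝ := Matrix.of fun i j => deriv (fun t : ℝ => (A + t • V)⁻¹ i j) 0 with hB
  have hB' (i j : n) : HasDerivAt (fun t : ℝ => (A + t • V)⁻¹ i j) (B i j) 0 :=
    ((hd i j).differentiableAt (by simp)).hasDerivAt
  have hmul (i j : n) : (B * A + A⁻¹ * V) i j = 0 := by
    have h1 : HasDerivAt (fun t : ℝ => ((A + t • V)⁻¹ * (A + t • V)) i j)
        ((B * A + A⁻¹ * V) i j) 0 := by
      have := HasDerivAt.fun_sum (u := Finset.univ) fun k _ => (hB' i k).mul (hV k j)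
      simpa [Matrix.mul_apply, Finset.sum_add_distrib] using this
    have h2 : ∀ᶠ t : ℝ in 𝓝 0, (A + t • V).det ≠ 0 := by
      refine (hasDerivAt_det_add_smul (V := V) hA).continuousAt.eventually_ne ?_
      simpa using hA.ne_zero
    refine h1.unique ((hasDerivAt_const (0 : ℝ) ((1 : Matrix n n ℝ) i j)).congr_of_eventuallyEq ?_)
    filter_upwards [h2] with t ht
    rw [Matrix.nonsing_inv_mul _ ht.isUnit]
  have h3 : B * A + A⁻¹ * V = 0 := by ext i j; simpa using hmul i j
  have h4 : B = -(A⁻¹ * V * A⁻¹) := by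
    rw [eq_neg_iff_add_eq_zero, ← Matrix.mul_nonsing_inv_cancel_right _ B hA, ← Matrix.add_mul, h3,
      Matrix.zero_mul]
  rw [← h4]
  exact hB' i j

end MatrixCalculus

/-! ### Algebra of the parametrization -/

section Parametrization

variable {r : ℕ}

@[simp] theorem loc_add (θ η : Par r) : loc (θ + η) = loc θ + loc η := rfl
@[simp] theorem loc_smul (t : ℝ) (θ : Par r) : loc (t • θ) = t • loc θ := rfl
@[simp] theorem scat_add (θ η : Par r) : scat (θ + η) = scat θ + scat η := rfl
@[simp] theorem scat_smul (t : ℝ) (θ : Par r) : scat (t • θ) = t • scat θ := rfl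

theorem scat_transpose (θ : Par r) : (scat θ)ᵀ = scat θ := by
  ext i j
  simp [scat, Sym2.eq_swap]

theorem inv_scat_transpose (θ : Par r) : ((scat θ)⁻¹)ᵀ = (scat θ)⁻¹ := by
  rw [Matrix.transpose_nonsing_inv, scat_transpose]

theorem dotProduct_mulVec_comm_of_transpose {n : Type*} [Fintype n] {A : Matrix n n ℝ}
    (hA : Aᵀ = A) (x y : n → ℝ) : x ⬝ᵥ A *ᵥ y = y ⬝ᵥ A *ᵥ x := by
  rw [Matrix.dotProduct_mulVec, ← Matrix.mulVec_transpose, hA, dotProduct_comm]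

theorem isUnit_det_scat {θ : Par r} (h : (scat θ).PosDef) : IsUnit (scat θ).det :=
  h.det_pos.ne'.isUnit

theorem mahal_nonneg {θ : Par r} (h : (scat θ).PosDef) (x : Fin r → ℝ) : 0 ≤ mahal θ x := by
  simpa [mahal] using h.inv.posSemidef.dotProduct_mulVec_nonneg (centred θ x)

/-- The homogeneous version `ν s₀² + (s₁ - s₀ μ)ᵀ Ψ⁻¹ (s₁ - s₀ μ)` of `ν + δ`. -/
def homQuad (ν : ℝ) (s : ℝ × (Fin r → ℝ)) (θ : Par r) : ℝ :=
  ν * s.1 ^ 2 + (s.2 - s.1 • loc θ) ⬝ᵥ ((scat θ)⁻¹ *ᵥ (s.2 - s.1 • loc θ))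

/-- The parameter dependent part of the logarithm of the `t_ν` density. -/
def logCore (ν : ℝ) (s : ℝ × (Fin r → ℝ)) (θ : Par r) : ℝ :=
  -(1 / 2) * Real.log (scat θ).det - (ν + r) / 2 * Real.log (homQuad ν s θ)

theorem homQuad_one (ν : ℝ) (x : Fin r → ℝ) (θ : Par r) :
    homQuad ν (1, x) θ = ν + mahal θ x := by
  simp [homQuad, mahal, centred]

theorem homQuad_smul (ν c : ℝ) (s : ℝ × (Fin r → ℝ)) (θ : Par r) :
    homQuad ν (c • s) θ = c ^ 2 * homQuad ν s θ := by
  have : (c • s).2 - (c • s).1 • loc θ = c • (s.2 - s.1 • loc θ) := by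
    simp [smul_sub, smul_smul]
  rw [homQuad, this, homQuad]
  simp [Matrix.mulVec_smul]
  ring

theorem homQuad_pos {ν : ℝ} (hν : 0 < ν) {s : ℝ × (Fin r → ℝ)} (hs : s ≠ 0) {θ : Par r}
    (h : (scat θ).PosDef) : 0 < homQuad ν s θ := by
  rcases eq_or_ne s.1 0 with h0 | h0
  · have : s.2 ≠ 0 := fun h2 => hs (Prod.ext h0 h2)
    simpa [homQuad, h0] using h.inv.dotProduct_mulVec_pos this
  · have h1 : 0 ≤ (s.2 - s.1 • loc θ) ⬝ᵥ ((scat θ)⁻¹ *ᵥ (s.2 - s.1 • loc θ)) := by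
      simpa using h.inv.posSemidef.dotProduct_mulVec_nonneg (s.2 - s.1 • loc θ)
    rw [homQuad]
    positivity

theorem logCore_smul {ν c : ℝ} (hν : 0 < ν) (hc : 0 < c) {s : ℝ × (Fin r → ℝ)} (hs : s ≠ 0)
    {θ : Par r} (h : (scat θ).PosDef) :
    logCore ν (c • s) θ = logCore ν s θ - (ν + r) * Real.log c := by
  rw [logCore, logCore, homQuad_smul, Real.log_mul (by positivity) (homQuad_pos hν hs h).ne',
    Real.log_pow]
  push_cast
  ring

theorem tNorm_pos {ν : ℝ} (hν : 0 < ν) : 0 < tNorm r ν := by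
  have := Real.Gamma_pos_of_pos (s := (ν + r) / 2) (by positivity)
  have := Real.Gamma_pos_of_pos (s := ν / 2) (by positivity)
  rw [tNorm]
  positivity

theorem one_add_mahal_pos {ν : ℝ} (hν : 0 < ν) {θ : Par r} (h : (scat θ).PosDef)
    (x : Fin r → ℝ) : 0 < 1 + mahal θ x / ν := by
  have := mahal_nonneg h x
  positivity

theorem tPdf_pos {ν : ℝ} (hν : 0 < ν) {θ : Par r} (h : (scat θ).PosDef) (x : Fin r → ℝ) :
    0 < tPdf ν θ x := by
  have := tNorm_pos (r := r) hν
  have := h.det_pos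
  have := one_add_mahal_pos hν h x
  rw [tPdf]
  positivity

theorem log_tPdf {ν : ℝ} (hν : 0 < ν) {θ : Par r} (h : (scat θ).PosDef) (x : Fin r → ℝ) :
    Real.log (tPdf ν θ x) = Real.log (tNorm r ν) - 1 / 2 * Real.log (scat θ).det
      - (ν + r) / 2 * Real.log (1 + mahal θ x / ν) := by
  have h1 := tNorm_pos (r := r) hν
  have h2 := h.det_pos
  have h3 := one_add_mahal_pos hν h x
  rw [tPdf, Real.log_mul (by positivity) (by positivity), Real.log_mul (by positivity)
    (by positivity), Real.log_rpow h2, Real.log_rpow h3]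
  ring

theorem log_tPdf_eq_logCore {ν : ℝ} (hν : 0 < ν) {θ : Par r} (h : (scat θ).PosDef)
    (x : Fin r → ℝ) :
    Real.log (tPdf ν θ x) =
      Real.log (tNorm r ν) + (ν + r) / 2 * Real.log ν + logCore ν (1, x) θ := by
  have h3 : 1 + mahal θ x / ν = (ν + mahal θ x) / ν := by field_simp
  have := mahal_nonneg h x
  rw [log_tPdf hν h, logCore, homQuad_one, h3, Real.log_div (by positivity) hν.ne']
  ring

theorem contDiffAt_uncurry_homQuad (ν : ℝ) {s : ℝ × (Fin r → ℝ)} {θ : Par r}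
    (h : (scat θ).PosDef) {k : ℕ∞} :
    ContDiffAt ℝ k (Function.uncurry (homQuad (r := r) ν)) (s, θ) := by
  have hP : ∀ i j, ContDiffAt ℝ k
      (fun p : (ℝ × (Fin r → ℝ)) × Par r => (scat p.2)⁻¹ i j) (s, θ) := fun i j =>
    contDiffAt_inv_apply (F := fun p : (ℝ × (Fin r → ℝ)) × Par r => scat p.2) (a := (s, θ))
      (fun i j => by simp only [scat, Matrix.of_apply]; fun_prop) (isUnit_det_scat h) i j
  have hc : ∀ i, ContDiffAt ℝ k
      (fun p : (ℝ × (Fin r → ℝ)) × Par r => (p.1.2 - p.1.1 • loc p.2) i) (s, θ) := fun i => by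
    simp only [loc, Pi.sub_apply, Pi.smul_apply, smul_eq_mul]; fun_prop
  simp only [Function.uncurry_def, homQuad, dotProduct, Matrix.mulVec]
  refine ContDiffAt.add (by fun_prop) (ContDiffAt.sum fun i _ => (hc i).mul
    (ContDiffAt.sum fun j _ => (hP i j).mul (hc j)))

theorem contDiffAt_uncurry_logCore {ν : ℝ} (hν : 0 < ν) {s : ℝ × (Fin r → ℝ)} (hs : s ≠ 0)
    {θ : Par r} (h : (scat θ).PosDef) {k : ℕ∞} :
    ContDiffAt ℝ k (Function.uncurry (logCore (r := r) ν)) (s, θ) := by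
  have hd : ContDiffAt ℝ k
      (fun p : (ℝ × (Fin r → ℝ)) × Par r => (scat p.2).det) (s, θ) :=
    contDiffAt_det fun i j => by simp only [scat, Matrix.of_apply]; fun_prop
  have hq := contDiffAt_uncurry_homQuad ν (s := s) h (k := k)
  exact (contDiffAt_const.mul (hd.log h.det_pos.ne')).sub
    (contDiffAt_const.mul (hq.log (homQuad_pos hν hs h).ne'))

theorem contDiffAt_logCore {ν : ℝ} (hν : 0 < ν) {s : ℝ × (Fin r → ℝ)} (hs : s ≠ 0)
    {θ : Par r} (h : (scat θ).PosDef) {k : ℕ∞} : ContDiffAt ℝ k (logCore ν s) θ :=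
  ContDiffAt.comp (g := Function.uncurry (logCore ν)) (f := fun θ => (s, θ)) θ
    (contDiffAt_uncurry_logCore hν hs h) (by fun_prop)

end Parametrization

/-! ### First and second derivative of the log-density -/

section Score

variable {r : ℕ}

/-- The standardized vector `Ψ⁻¹ (x - μ)`. -/
def stdVec (θ : Par r) (x : Fin r → ℝ) : Fin r → ℝ := (scat θ)⁻¹ *ᵥ centred θ x

/-- Half the derivative of `δ` along `v`, with opposite sign. -/
def mahalSlope (θ : Par r) (x : Fin r → ℝ) (v : Par r) : ℝ :=
  loc v ⬝ᵥ stdVec θ x + 1 / 2 * (stdVec θ x ⬝ᵥ scat v *ᵥ stdVec θ x)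

/-- The derivative of the log-density along `v`. -/
def score (ν : ℝ) (x : Fin r → ℝ) (θ v : Par r) : ℝ :=
  -(1 / 2) * ((scat θ)⁻¹ * scat v).trace + weight ν θ x * mahalSlope θ x v

/-- The second derivative of the log-density along `u` and `v`. -/
def scoreDeriv (ν : ℝ) (x : Fin r → ℝ) (θ u v : Par r) : ℝ :=
  1 / 2 * ((scat θ)⁻¹ * scat u * (scat θ)⁻¹ * scat v).trace
    + 2 / (ν + r) * weight ν θ x ^ 2 * mahalSlope θ x u * mahalSlope θ x v
    - weight ν θ x * (loc v ⬝ᵥ (scat θ)⁻¹ *ᵥ scat u *ᵥ stdVec θ x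
        + loc v ⬝ᵥ (scat θ)⁻¹ *ᵥ loc u
        + stdVec θ x ⬝ᵥ scat v *ᵥ (scat θ)⁻¹ *ᵥ scat u *ᵥ stdVec θ x
        + stdVec θ x ⬝ᵥ scat v *ᵥ (scat θ)⁻¹ *ᵥ loc u)

variable {a : Par r} (ha : (scat a).PosDef) (x : Fin r → ℝ) (u v : Par r)

theorem hasDerivAt_centred :
    HasDerivAt (fun t : ℝ => centred (a + t • u) x) (-loc u) 0 := by
  have h : (fun t : ℝ => centred (a + t • u) x) = fun t => (x - loc a) - t • loc u := by
    ext t; simp [centred]; ring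
  rw [h]
  simpa using ((hasDerivAt_id (0 : ℝ)).smul_const (loc u)).const_sub (x - loc a)

include ha

theorem hasDerivAt_stdVec :
    HasDerivAt (fun t : ℝ => stdVec (a + t • u) x)
      (-((scat a)⁻¹ *ᵥ scat u *ᵥ stdVec a x) - (scat a)⁻¹ *ᵥ loc u) 0 := by
  have := hasDerivAt_mulVec (fun i j => hasDerivAt_inv_add_smul (V := scat u)
    (isUnit_det_scat ha) i j) (hasDerivAt_centred (a := a) x u)
  simpa [stdVec, Matrix.neg_mulVec, Matrix.mulVec_neg, Matrix.mulVec_mulVec, Matrix.mul_assoc,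
    sub_eq_add_neg] using this

theorem hasDerivAt_mahal :
    HasDerivAt (fun t : ℝ => mahal (a + t • u) x) (-2 * mahalSlope a x u) 0 := by
  have := hasDerivAt_dotProduct (hasDerivAt_centred (a := a) x u) (hasDerivAt_stdVec ha x u)
  refine this.congr_deriv ?_
  have hP := inv_scat_transpose a
  have h1 : centred a x ⬝ᵥ (scat a)⁻¹ *ᵥ scat u *ᵥ stdVec a x
      = stdVec a x ⬝ᵥ scat u *ᵥ stdVec a x := by
    rw [dotProduct_mulVec_comm_of_transpose hP, dotProduct_comm]; rfl
  have h2 : centred a x ⬝ᵥ (scat a)⁻¹ *ᵥ loc u = loc u ⬝ᵥ stdVec a x := by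
    rw [dotProduct_mulVec_comm_of_transpose hP]; rfl
  simp only [zero_smul, add_zero, dotProduct_sub, dotProduct_neg, neg_dotProduct, h1, h2,
    mahalSlope]
  ring

theorem hasDerivAt_mahalSlope :
    HasDerivAt (fun t : ℝ => mahalSlope (a + t • u) x v)
      (-(loc v ⬝ᵥ (scat a)⁻¹ *ᵥ scat u *ᵥ stdVec a x + loc v ⬝ᵥ (scat a)⁻¹ *ᵥ loc u
        + stdVec a x ⬝ᵥ scat v *ᵥ (scat a)⁻¹ *ᵥ scat u *ᵥ stdVec a x
        + stdVec a x ⬝ᵥ scat v *ᵥ (scat a)⁻¹ *ᵥ loc u)) 0 := by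
  have hy := hasDerivAt_stdVec ha x u
  have hVy := hasDerivAt_mulVec (A := fun _ => scat v) (A' := 0)
    (fun i j => hasDerivAt_const (0 : ℝ) _) hy
  have := (hasDerivAt_dotProduct (hasDerivAt_const (0 : ℝ) (loc v)) hy).fun_add
    ((hasDerivAt_dotProduct hy hVy).const_mul (1 / 2))
  refine this.congr_deriv ?_
  set y' := -((scat a)⁻¹ *ᵥ scat u *ᵥ stdVec a x) - (scat a)⁻¹ *ᵥ loc u with hy'
  have h1 : y' ⬝ᵥ scat v *ᵥ stdVec a x = stdVec a x ⬝ᵥ scat v *ᵥ y' :=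
    dotProduct_mulVec_comm_of_transpose (scat_transpose v) _ _
  simp only [zero_smul, add_zero, zero_dotProduct, zero_add, Matrix.zero_mulVec, h1]
  simp only [hy', dotProduct_sub, dotProduct_neg, Matrix.mulVec_sub, Matrix.mulVec_neg]
  ring

variable {ν : ℝ} (hν : 0 < ν)
include hν

theorem hasDerivAt_weight :
    HasDerivAt (fun t : ℝ => weight ν (a + t • u) x)
      (2 / (ν + r) * weight ν a x ^ 2 * mahalSlope a x u) 0 := by
  have h0 : 0 < ν + mahal a x := by have := mahal_nonneg ha x; positivity
  have hr : 0 < ν + r := by positivity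
  have := (hasDerivAt_const (0 : ℝ) (ν + r)).fun_div ((hasDerivAt_mahal ha x u).const_add ν)
    (by simpa using h0.ne')
  refine this.congr_deriv ?_
  simp only [weight, zero_smul, add_zero]
  field_simp
  ring

theorem hasDerivAt_score :
    HasDerivAt (fun t : ℝ => score ν x (a + t • u) v) (scoreDeriv ν x a u v) 0 := by
  have h1 : HasDerivAt (fun t : ℝ => ((scat (a + t • u))⁻¹ * scat v).trace)
      (-((scat a)⁻¹ * scat u * (scat a)⁻¹ * scat v)).trace 0 := by
    refine hasDerivAt_trace fun i j => ?_
    have := HasDerivAt.fun_sum (u := Finset.univ) fun k _ =>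
      (hasDerivAt_inv_add_smul (V := scat u) (isUnit_det_scat ha) i k).mul_const (scat v k j)
    simp only [← Matrix.mul_apply] at this
    simp only [Matrix.neg_mul] at this
    exact this
  have := (h1.const_mul (-(1 / 2))).fun_add
    ((hasDerivAt_weight ha x u hν).fun_mul (hasDerivAt_mahalSlope ha x u v))
  refine this.congr_deriv ?_
  simp only [zero_smul, add_zero, Matrix.trace_neg, scoreDeriv]
  ring

theorem hasDerivAt_logCore :
    HasDerivAt (fun t : ℝ => logCore ν (1, x) (a + t • u)) (score ν x a u) 0 := by
  have h0 : 0 < ν + mahal a x := by have := mahal_nonneg ha x; positivity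
  have h1 := (hasDerivAt_det_add_smul (V := scat u) (isUnit_det_scat ha)).log
    (by simpa using ha.det_pos.ne')
  have h2 := ((hasDerivAt_mahal ha x u).const_add ν).log (by simpa using h0.ne')
  have := (h1.const_mul (-(1 / 2))).fun_sub (h2.const_mul ((ν + r) / 2))
  simp only [logCore, homQuad_one]
  refine this.congr_deriv ?_
  have := ha.det_pos.ne'
  simp only [score, weight, zero_smul, add_zero]
  field_simp
  ring

theorem fderiv_logCore : fderiv ℝ (logCore ν (1, x)) a u = score ν x a u := by
  have h1 : DifferentiableAt ℝ (logCore ν (1, x)) a :=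
    (contDiffAt_logCore (k := 1) hν (by simp) ha).differentiableAt (by simp)
  have h2 : HasDerivAt (fun t : ℝ => a + t • u) u 0 := by
    simpa using ((hasDerivAt_id (0 : ℝ)).smul_const u).const_add a
  have h3 := HasFDerivAt.comp_hasDerivAt_of_eq (0 : ℝ) h1.hasFDerivAt h2 (by simp)
  exact h3.unique (hasDerivAt_logCore ha x u hν)

theorem fderiv_fderiv_logCore (hev : ∀ᶠ θ in 𝓝 a, (scat θ).PosDef) :
    fderiv ℝ (fderiv ℝ (logCore ν (1, x))) a u v = scoreDeriv ν x a u v := by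
  have h1 : DifferentiableAt ℝ (fderiv ℝ (logCore ν (1, x))) a :=
    ((contDiffAt_logCore (k := 2) hν (by simp) ha).fderiv_right (m := 1)
      (by norm_num)).differentiableAt (by simp)
  have h2 : HasDerivAt (fun t : ℝ => a + t • u) u 0 := by
    simpa using ((hasDerivAt_id (0 : ℝ)).smul_const u).const_add a
  have h3 := (HasFDerivAt.comp_hasDerivAt_of_eq (0 : ℝ) h1.hasFDerivAt h2 (by simp)).clm_apply
    (hasDerivAt_const (0 : ℝ) v)
  have hev' : ∀ᶠ t : ℝ in 𝓝 0, (scat (a + t • u)).PosDef :=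
    h2.continuousAt.eventually (by simpa using hev)
  have h4 : HasDerivAt (fun t : ℝ => fderiv ℝ (logCore ν (1, x)) (a + t • u) v)
      (scoreDeriv ν x a u v) 0 := by
    refine (hasDerivAt_score ha x u v hν).congr_of_eventuallyEq ?_
    filter_upwards [hev'] with t ht
    exact fderiv_logCore ht x v hν
  simpa using h3.unique h4

end Score

/-! ### The likelihood of clustered data -/

section Symmetrize

variable {r : ℕ}

/-- The parameter whose location is `μ` and whose scatter matrix is the symmetric part of `V`. -/
def parOfMatrix (μ : Fin r → ℝ) (V : Matrix (Fin r) (Fin r) ℝ) : Par r :=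
  Sum.elim μ (Sym2.lift ⟨fun i j : Fin r => (V i j + V j i) / 2, fun i j => by simp [add_comm]⟩)

theorem loc_parOfMatrix (μ : Fin r → ℝ) (V : Matrix (Fin r) (Fin r) ℝ) :
    loc (parOfMatrix μ V) = μ := rfl

theorem scat_parOfMatrix (μ : Fin r → ℝ) (V : Matrix (Fin r) (Fin r) ℝ) :
    scat (parOfMatrix μ V) = (1 / 2 : ℝ) • (V + Vᵀ) := by
  ext i j
  simp [scat, parOfMatrix]
  ring

end Symmetrize

theorem ModelFamily.eventually_update_mem {r : ℕ} (M : ModelFamily r) {l : M.Idx}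
    {Θ : Fin l.1 → Par r} (hΘ : Θ ∈ interior (M.Ω l)) (m : Fin l.1) :
    ∀ᶠ θ in 𝓝 (Θ m), Function.update Θ m θ ∈ M.Ω l := by
  have hc : ContinuousAt (fun θ => Function.update Θ m θ) (Θ m) :=
    (continuous_const.update m continuous_id).continuousAt
  exact hc.eventually (by simpa using mem_interior_iff_mem_nhds.1 hΘ)

theorem ModelFamily.eventually_posDef {r : ℕ} (M : ModelFamily r) {l : M.Idx}
    {Θ : Fin l.1 → Par r} (hΘ : Θ ∈ interior (M.Ω l)) (m : Fin l.1) :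
    ∀ᶠ θ in 𝓝 (Θ m), (scat θ).PosDef := by
  filter_upwards [M.eventually_update_mem hΘ m] with θ hθ
  simpa using M.Ω_posDef l _ hθ m

namespace ClusteredData

variable {r : ℕ} {M : ModelFamily r} {N : ℕ} (S : ClusteredData M N) (l : M.Idx)

theorem mem_cluster {m : Fin l.1} {n : Fin N} : n ∈ S.cluster l m ↔ S.label l n = m := by
  simp [cluster]

theorem size_pos_of_surjective (h : Function.Surjective (S.label l)) (m : Fin l.1) :
    0 < S.size l m := by
  obtain ⟨n, hn⟩ := h m
  exact Finset.card_pos.2 ⟨n, (S.mem_cluster l).2 hn⟩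

theorem sum_size : ∑ m, S.size l m = N := by
  have := Finset.card_eq_sum_card_fiberwise (f := S.label l) (s := Finset.univ)
    (t := Finset.univ) (fun _ _ => Finset.mem_coe.2 (Finset.mem_univ _))
  simpa [size, cluster] using this.symm

theorem size_le (m : Fin l.1) : S.size l m ≤ N := by
  simpa [size] using Finset.card_le_univ (S.cluster l m)

theorem mixing_pos {m : Fin l.1} {n : Fin N} (hn : n ∈ S.cluster l m) :
    0 < (S.size l m : ℝ) / N := by
  have h1 : 0 < S.size l m := Finset.card_pos.2 ⟨n, hn⟩
  have h2 : 0 < N := h1.trans_le (S.size_le l m)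
  positivity

theorem clusterLik_pos {m : Fin l.1} {θ : Par r} (h : (scat θ).PosDef) :
    0 < S.clusterLik l m θ :=
  Finset.prod_pos fun _ hn => mul_pos (S.mixing_pos l hn) (tPdf_pos (M.ν_pos l m) h _)

theorem lik_pos {Θ : Fin l.1 → Par r} (h : ∀ m, (scat (Θ m)).PosDef) : 0 < S.lik l Θ :=
  Finset.prod_pos fun m _ => S.clusterLik_pos l (h m)

theorem logLik_eq_sum {Θ : Fin l.1 → Par r} (h : ∀ m, (scat (Θ m)).PosDef) :
    S.logLik l Θ = ∑ m, Real.log (S.clusterLik l m (Θ m)) :=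
  Real.log_prod fun m _ => (S.clusterLik_pos l (h m)).ne'

theorem log_clusterLik {m : Fin l.1} {θ : Par r} (h : (scat θ).PosDef) :
    Real.log (S.clusterLik l m θ) =
      ∑ n ∈ S.cluster l m, (Real.log ((S.size l m : ℝ) / N)
        + Real.log (tPdf (M.ν l m) θ (S.x n))) := by
  rw [clusterLik, Real.log_prod fun n hn =>
    (mul_pos (S.mixing_pos l hn) (tPdf_pos (M.ν_pos l m) h _)).ne']
  exact Finset.sum_congr rfl fun n hn => Real.log_mul (S.mixing_pos l hn).ne'
    (tPdf_pos (M.ν_pos l m) h _).ne'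

theorem log_clusterLik_eq_logCore {m : Fin l.1} {θ : Par r} (h : (scat θ).PosDef) :
    Real.log (S.clusterLik l m θ) =
      S.size l m * (Real.log ((S.size l m : ℝ) / N) + (Real.log (tNorm r (M.ν l m))
        + (M.ν l m + r) / 2 * Real.log (M.ν l m)))
      + ∑ n ∈ S.cluster l m, logCore (M.ν l m) (1, S.x n) θ := by
  rw [S.log_clusterLik l h]
  simp_rw [log_tPdf_eq_logCore (M.ν_pos l m) h, ← add_assoc]
  rw [Finset.sum_add_distrib, Finset.sum_const, nsmul_eq_mul]
  rfl

/-- The logarithm of the likelihood of one cluster. -/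
def clusterLogLik (m : Fin l.1) (θ : Par r) : ℝ := Real.log (S.clusterLik l m θ)

section Derivatives

variable {m : Fin l.1} {a : Par r} (ha : ∀ᶠ θ in 𝓝 a, (scat θ).PosDef)
include ha

theorem fderiv_clusterLogLik :
    fderiv ℝ (S.clusterLogLik l m) a =
      ∑ n ∈ S.cluster l m, fderiv ℝ (logCore (M.ν l m) (1, S.x n)) a := by
  have h : S.clusterLogLik l m =ᶠ[𝓝 a] _ := ha.mono fun θ h => S.log_clusterLik_eq_logCore l h
  rw [h.fderiv_eq, fderiv_const_add, fderiv_fun_sum]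
  exact fun n _ => (contDiffAt_logCore (k := 1) (M.ν_pos l m) (by simp)
    ha.self_of_nhds).differentiableAt (by simp)

theorem fderiv_fderiv_clusterLogLik :
    fderiv ℝ (fderiv ℝ (S.clusterLogLik l m)) a =
      ∑ n ∈ S.cluster l m, fderiv ℝ (fderiv ℝ (logCore (M.ν l m) (1, S.x n))) a := by
  have h : fderiv ℝ (S.clusterLogLik l m) =ᶠ[𝓝 a] _ :=
    ha.eventually_nhds.mono fun θ h => S.fderiv_clusterLogLik l h
  rw [h.fderiv_eq, fderiv_fun_sum]
  exact fun n _ => ((contDiffAt_logCore (k := 2) (M.ν_pos l m) (by simp)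
    ha.self_of_nhds).fderiv_right (m := 1) (by norm_num)).differentiableAt (by simp)

theorem contDiffAt_clusterLogLik {k : ℕ∞} : ContDiffAt ℝ k (S.clusterLogLik l m) a := by
  have h : S.clusterLogLik l m =ᶠ[𝓝 a] _ := ha.mono fun θ h => S.log_clusterLik_eq_logCore l h
  refine ContDiffAt.congr_of_eventuallyEq ?_ h
  exact contDiffAt_const.add (ContDiffAt.sum fun n _ => contDiffAt_logCore (M.ν_pos l m) (by simp)
    ha.self_of_nhds)

end Derivatives

/-! ### Consequences of maximality -/

section Interior

variable {l} (hi : S.est l ∈ interior (M.Ω l))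
include hi

theorem est_posDef (m : Fin l.1) : (scat (S.est l m)).PosDef :=
  M.Ω_posDef l _ (interior_subset hi) m

theorem eventually_posDef (m : Fin l.1) : ∀ᶠ θ in 𝓝 (S.est l m), (scat θ).PosDef :=
  M.eventually_posDef hi m

end Interior

variable {l}

theorem fderiv_clusterLogLik_est (h : S.IsMLE l) (m : Fin l.1) :
    fderiv ℝ (S.clusterLogLik l m) (S.est l m) = 0 := by
  refine IsLocalMax.fderiv_eq_zero ?_
  filter_upwards [M.eventually_update_mem h.1 m] with θ hθ
  have h1 : S.logLik l (Function.update (S.est l) m θ) ≤ S.logLik l (S.est l) := h.2 hθ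
  rw [S.logLik_eq_sum l (M.Ω_posDef l _ hθ),
    S.logLik_eq_sum l (M.Ω_posDef l _ (interior_subset h.1)),
    ← Finset.add_sum_erase _ _ (Finset.mem_univ m),
    ← Finset.add_sum_erase _ _ (Finset.mem_univ m)] at h1
  have h2 : ∑ k ∈ Finset.univ.erase m, Real.log (S.clusterLik l k
      (Function.update (S.est l) m θ k)) =
      ∑ k ∈ Finset.univ.erase m, Real.log (S.clusterLik l k (S.est l k)) :=
    Finset.sum_congr rfl fun k hk => by rw [Function.update_of_ne (Finset.ne_of_mem_erase hk)]
  rw [h2] at h1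
  rw [Function.update_self] at h1
  exact le_of_add_le_add_right h1

section MLE

variable (h : S.IsMLE l) (m : Fin l.1)
include h

theorem sum_score_est (v : Par r) :
    ∑ n ∈ S.cluster l m, score (M.ν l m) (S.x n) (S.est l m) v = 0 := by
  have h1 := S.fderiv_clusterLogLik_est h m
  rw [S.fderiv_clusterLogLik l (S.eventually_posDef h.1 m)] at h1
  have h2 := congrArg (fun L => L v) h1
  simp only [sum_apply] at h2
  rw [← Finset.sum_congr rfl fun n _ =>
    fderiv_logCore (S.est_posDef h.1 m) (S.x n) v (M.ν_pos l m)]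
  simpa using h2

/-- The standardized vector at the estimate. -/
def resid (m : Fin l.1) (n : Fin N) : Fin r → ℝ := stdVec (S.est l m) (S.x n)

theorem sum_weight_dotProduct (k : Fin r → ℝ) :
    ∑ n ∈ S.cluster l m, S.w l m n * (k ⬝ᵥ S.resid m n) = 0 := by
  have := S.sum_score_est h m (parOfMatrix k 0)
  simpa [score, scat_parOfMatrix, loc_parOfMatrix, mahalSlope, w, resid] using this

theorem sum_weight_quadratic (V : Matrix (Fin r) (Fin r) ℝ) :
    ∑ n ∈ S.cluster l m, S.w l m n * (S.resid m n ⬝ᵥ V *ᵥ S.resid m n) =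
      S.size l m * (S.prec l m * V).trace := by
  have h1 := S.sum_score_est h m (parOfMatrix 0 V)
  have h2 (y : Fin r → ℝ) : y ⬝ᵥ Vᵀ *ᵥ y = y ⬝ᵥ V *ᵥ y := by
    rw [Matrix.mulVec_transpose, dotProduct_comm, Matrix.dotProduct_mulVec]
  have h3 : (S.prec l m * Vᵀ).trace = (S.prec l m * V).trace := by
    rw [← Matrix.trace_transpose, Matrix.transpose_mul, Matrix.transpose_transpose,
      Matrix.trace_mul_comm]
    simp only [prec, inv_scat_transpose]
  have h4 (n : Fin N) : score (M.ν l m) (S.x n) (S.est l m) (parOfMatrix 0 V) =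
      -(1 / 2) * (S.prec l m * V).trace
        + 1 / 2 * (S.w l m n * (S.resid m n ⬝ᵥ V *ᵥ S.resid m n)) := by
    rw [score, mahalSlope, scat_parOfMatrix, loc_parOfMatrix, Matrix.mul_smul, Matrix.trace_smul,
      Matrix.mul_add, Matrix.trace_add, Matrix.smul_mulVec, Matrix.add_mulVec, dotProduct_smul,
      dotProduct_add, h2]
    change -(1 / 2) * (1 / 2 : ℝ) • ((S.prec l m * V).trace + (S.prec l m * Vᵀ).trace) + _ = _
    rw [h3]
    simp only [smul_eq_mul, zero_dotProduct, resid, w]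
    ring
  simp_rw [h4] at h1
  rw [Finset.sum_add_distrib, Finset.sum_const, nsmul_eq_mul, ← Finset.mul_sum] at h1
  change (S.size l m : ℝ) * _ + _ = 0 at h1
  linarith

theorem fderiv_fderiv_clusterLogLik_est (u v : Par r) :
    fderiv ℝ (fderiv ℝ (S.clusterLogLik l m)) (S.est l m) u v =
      -(S.size l m / 2) * (S.prec l m * scat u * S.prec l m * scat v).trace
      + 2 / (M.ν l m + r) * ∑ n ∈ S.cluster l m, S.w l m n ^ 2 *
          (mahalSlope (S.est l m) (S.x n) u * mahalSlope (S.est l m) (S.x n) v)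
      - (∑ n ∈ S.cluster l m, S.w l m n) * (loc v ⬝ᵥ S.prec l m *ᵥ loc u) := by
  have hP : (S.prec l m)ᵀ = S.prec l m := inv_scat_transpose _
  have hev := S.eventually_posDef h.1 m
  rw [S.fderiv_fderiv_clusterLogLik l hev]
  simp only [sum_apply]
  rw [Finset.sum_congr rfl fun n _ => fderiv_fderiv_logCore (S.est_posDef h.1 m) (S.x n) u v
    (M.ν_pos l m) hev]
  have h1 : ∑ n ∈ S.cluster l m, S.w l m n * (loc v ⬝ᵥ S.prec l m *ᵥ scat u *ᵥ S.resid m n) = 0 := by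
    rw [← S.sum_weight_dotProduct h m (scat u *ᵥ S.prec l m *ᵥ loc v)]
    refine Finset.sum_congr rfl fun n _ => ?_
    rw [dotProduct_mulVec_comm_of_transpose hP, dotProduct_comm,
      dotProduct_mulVec_comm_of_transpose (scat_transpose u), dotProduct_comm]
  have h2 : ∑ n ∈ S.cluster l m, S.w l m n * (S.resid m n ⬝ᵥ scat v *ᵥ S.prec l m *ᵥ loc u) = 0 := by
    rw [← S.sum_weight_dotProduct h m (scat v *ᵥ S.prec l m *ᵥ loc u)]
    exact Finset.sum_congr rfl fun n _ => by rw [dotProduct_comm]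
  have h3 : ∑ n ∈ S.cluster l m, S.w l m n *
      (S.resid m n ⬝ᵥ scat v *ᵥ S.prec l m *ᵥ scat u *ᵥ S.resid m n) =
      S.size l m * (S.prec l m * scat u * S.prec l m * scat v).trace := by
    have := S.sum_weight_quadratic h m (scat v * S.prec l m * scat u)
    simp only [← Matrix.mulVec_mulVec] at this
    rw [this, Matrix.mul_assoc (S.prec l m * scat u), Matrix.trace_mul_comm (S.prec l m * scat u)]
    simp only [Matrix.mul_assoc]
  have h4 (n : Fin N) : scoreDeriv (M.ν l m) (S.x n) (S.est l m) u v =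
      1 / 2 * (S.prec l m * scat u * S.prec l m * scat v).trace
      + 2 / (M.ν l m + r) * (S.w l m n ^ 2 *
          (mahalSlope (S.est l m) (S.x n) u * mahalSlope (S.est l m) (S.x n) v))
      - S.w l m n * (loc v ⬝ᵥ S.prec l m *ᵥ scat u *ᵥ S.resid m n)
      - S.w l m n * (loc v ⬝ᵥ S.prec l m *ᵥ loc u)
      - S.w l m n * (S.resid m n ⬝ᵥ scat v *ᵥ S.prec l m *ᵥ scat u *ᵥ S.resid m n)
      - S.w l m n * (S.resid m n ⬝ᵥ scat v *ᵥ S.prec l m *ᵥ loc u) := by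
    simp only [scoreDeriv, prec, w, resid]
    ring
  simp_rw [h4]
  simp only [Finset.sum_sub_distrib, Finset.sum_add_distrib, h1, h2, h3, Finset.sum_const,
    nsmul_eq_mul, ← Finset.mul_sum, ← Finset.sum_mul]
  change (S.size l m : ℝ) * _ + _ - _ - _ - _ - _ = _
  ring

end MLE

end ClusteredData

/-! ### The blocks of the Fisher information matrix -/

section Duplication

variable {r : ℕ}

theorem loc_single_inl (i : Fin r) :
    loc (Pi.single (Sum.inl i) 1 : Par r) = Pi.single i 1 := by
  ext j
  simp [loc, Pi.single_apply]

theorem loc_single_inr (s : Sym2 (Fin r)) : loc (Pi.single (Sum.inr s) 1 : Par r) = 0 := by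
  ext j
  simp [loc]

theorem scat_single_inl (i : Fin r) : scat (Pi.single (Sum.inl i) 1 : Par r) = 0 := by
  ext j k
  simp [scat]

theorem single_inr_comp (s : Sym2 (Fin r)) :
    (fun t => (Pi.single (Sum.inr s) 1 : Par r) (Sum.inr t)) = Pi.single s 1 := by
  ext t
  simp [Pi.single_apply]

theorem vec_scat_single_inr (s : Sym2 (Fin r)) :
    (scat (Pi.single (Sum.inr s) 1 : Par r)).vec = fun p => dupMat r p s := by
  rw [vec_scat, single_inr_comp, Matrix.mulVec_single_one]
  rfl

theorem dotProduct_transpose_dupMat_mul_mul_mulVec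
    (K : Matrix (Fin r × Fin r) (Fin r × Fin r) ℝ) (u v : Par r) :
    (fun s => u (Sum.inr s)) ⬝ᵥ ((dupMat r)ᵀ * K * dupMat r) *ᵥ (fun s => v (Sum.inr s)) =
      (scat u).vec ⬝ᵥ K *ᵥ (scat v).vec := by
  rw [vec_scat, vec_scat, Matrix.mul_assoc, ← Matrix.mulVec_mulVec, ← Matrix.mulVec_mulVec,
    Matrix.dotProduct_mulVec, Matrix.vecMul_transpose]

theorem trace_mul_vecMulVec_mul_vecMulVec (A B : Matrix (Fin r) (Fin r) ℝ) (y : Fin r → ℝ) :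
    (A * (Matrix.vecMulVec y y * B * Matrix.vecMulVec y y)).trace =
      (y ⬝ᵥ A *ᵥ y) * (y ⬝ᵥ B *ᵥ y) := by
  rw [Matrix.vecMulVec_mul, Matrix.vecMulVec_mul_vecMulVec, Matrix.vecMulVec_smul, Matrix.mul_smul, Matrix.trace_smul,
    Matrix.mul_vecMulVec, Matrix.trace_vecMulVec, ← Matrix.dotProduct_mulVec, smul_eq_mul,
    mul_comm, dotProduct_comm (A *ᵥ y)]

end Duplication

namespace ClusteredData

variable {r : ℕ} {M : ModelFamily r} {N : ℕ} (S : ClusteredData M N) {l : M.Idx} (m : Fin l.1)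

theorem prec_transpose : (S.prec l m)ᵀ = S.prec l m := inv_scat_transpose _

theorem prec_mul_outer_mul_prec (n : Fin N) :
    S.prec l m * S.outer l m n * S.prec l m = Matrix.vecMulVec (S.resid m n) (S.resid m n) := by
  rw [outer, Matrix.mul_vecMulVec, Matrix.vecMulVec_mul, ← Matrix.mulVec_transpose,
    prec_transpose]
  rfl

theorem Jmm_apply (i j : Fin r) :
    S.Jmm l m i j = 2 / (M.ν l m + r) * ∑ n ∈ S.cluster l m, S.w l m n ^ 2 *
      (S.resid m n i * S.resid m n j) - (∑ n ∈ S.cluster l m, S.w l m n) * S.prec l m i j := by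
  simp [Jmm, Finset.mul_sum, Finset.sum_mul, prec_mul_outer_mul_prec, Matrix.sum_apply,
    Matrix.vecMulVec_apply]

theorem JmP_apply (i : Fin r) (s : Sym2 (Fin r)) :
    S.JmP l m i s = 1 / (M.ν l m + r) * ∑ n ∈ S.cluster l m, S.w l m n ^ 2 *
      (S.resid m n i * (S.resid m n ⬝ᵥ
        scat (Pi.single (Sum.inr s) 1 : Par r) *ᵥ S.resid m n)) := by
  have hrow (n : Fin N) (j : Fin r) :
      (Matrix.replicateRow Unit (S.xt l m n) * S.prec l m) () j = S.resid m n j := by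
    have : S.resid m n = S.xt l m n ᵥ* S.prec l m := by
      rw [← Matrix.mulVec_transpose, prec_transpose]; rfl
    rw [this]
    rfl
  have hD (a b : Fin r) : dupMat r (a, b) s = scat (Pi.single (Sum.inr s) 1 : Par r) a b := by
    have := congrFun (vec_scat_single_inr s) (b, a)
    simp only [Matrix.vec] at this
    rw [this]
    simp [dupMat, Sym2.eq_swap]
  simp only [JmP, Matrix.smul_apply, Matrix.sum_apply, smul_eq_mul, Matrix.mul_apply,
    Matrix.submatrix_apply, id, prec_mul_outer_mul_prec, Matrix.kroneckerMap_apply,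
    Matrix.vecMulVec_apply, Fintype.sum_prod_type]
  congr 1
  refine Finset.sum_congr rfl fun n _ => ?_
  congr 1
  simp only [← Matrix.mul_apply, hrow, hD, dotProduct, Matrix.mulVec, Finset.mul_sum]
  refine Finset.sum_congr rfl fun a _ => Finset.sum_congr rfl fun b _ => ?_
  ring

theorem dotProduct_JPP_mulVec (u v : Par r) :
    (fun s => u (Sum.inr s)) ⬝ᵥ S.JPP l m *ᵥ (fun s => v (Sum.inr s)) =
      -(S.size l m / 2) * (S.prec l m * scat u * S.prec l m * scat v).trace
      + 1 / (2 * (M.ν l m + r)) * ∑ n ∈ S.cluster l m, S.w l m n ^ 2 *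
        ((S.resid m n ⬝ᵥ scat u *ᵥ S.resid m n) * (S.resid m n ⬝ᵥ scat v *ᵥ S.resid m n)) := by
  have h1 : (dupMat r)ᵀ * (S.prec l m ⊗ₖ S.prec l m)
        * (∑ n ∈ S.cluster l m, S.w l m n ^ 2 • (S.outer l m n ⊗ₖ S.outer l m n))
        * (S.prec l m ⊗ₖ S.prec l m) * dupMat r =
      ∑ n ∈ S.cluster l m, S.w l m n ^ 2 • ((dupMat r)ᵀ *
        (Matrix.vecMulVec (S.resid m n) (S.resid m n) ⊗ₖ
          Matrix.vecMulVec (S.resid m n) (S.resid m n)) * dupMat r) := by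
    simp only [Matrix.mul_sum, Matrix.sum_mul, Matrix.mul_smul, Matrix.smul_mul,
      ← prec_mul_outer_mul_prec, Matrix.mul_kronecker_mul, Matrix.mul_assoc]
  rw [JPP, h1]
  simp only [Matrix.add_mulVec, Matrix.neg_mulVec, Matrix.smul_mulVec, Matrix.sum_mulVec,
    dotProduct_add, dotProduct_neg, dotProduct_smul, dotProduct_sum,
    dotProduct_transpose_dupMat_mul_mul_mulVec, Matrix.kronecker_mulVec_vec,
    Matrix.vec_dotProduct_vec, scat_transpose, prec_transpose, Matrix.transpose_vecMulVec,
    smul_eq_mul, trace_mul_vecMulVec_mul_vecMulVec]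
  congr 1
  rw [← Matrix.mul_assoc, ← Matrix.mul_assoc, Matrix.trace_mul_comm]
  simp only [Matrix.mul_assoc]
  ring

theorem JPP_apply (s s' : Sym2 (Fin r)) :
    S.JPP l m s s' = -(S.size l m / 2) * (S.prec l m * scat (Pi.single (Sum.inr s) 1 : Par r)
        * S.prec l m * scat (Pi.single (Sum.inr s') 1 : Par r)).trace
      + 1 / (2 * (M.ν l m + r)) * ∑ n ∈ S.cluster l m, S.w l m n ^ 2 *
        ((S.resid m n ⬝ᵥ scat (Pi.single (Sum.inr s) 1 : Par r) *ᵥ S.resid m n) *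
          (S.resid m n ⬝ᵥ scat (Pi.single (Sum.inr s') 1 : Par r) *ᵥ S.resid m n)) := by
  rw [← dotProduct_JPP_mulVec, single_inr_comp, single_inr_comp]
  simp

variable (h : S.IsMLE l)
include h

theorem fim_eq_fromBlocks : S.fim l m =
    Matrix.fromBlocks (-S.Jmm l m) (-S.JmP l m) (-(S.JmP l m)ᵀ) (-S.JPP l m) := by
  have hf (i j : ParIdx r) : S.fim l m i j = -_ :=
    congrArg Neg.neg (S.fderiv_fderiv_clusterLogLik_est h m (Pi.single i 1) (Pi.single j 1))
  ext (i | s) (j | s')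
  · rw [hf]
    have hP : S.prec l m j i = S.prec l m i j := by
      conv_lhs => rw [← S.prec_transpose m]
      rfl
    simp [Jmm_apply, loc_single_inl, scat_single_inl, mahalSlope, resid, hP]
  · rw [hf]
    simp only [JmP_apply, Matrix.fromBlocks_apply₁₂, Matrix.neg_apply, loc_single_inl,
      scat_single_inl, mahalSlope, resid, loc_single_inr]
    simp [Finset.mul_sum]
    refine Finset.sum_congr rfl fun n _ => ?_
    ring
  · rw [hf]
    simp only [JmP_apply, Matrix.fromBlocks_apply₂₁, Matrix.neg_apply, loc_single_inl,
      scat_single_inl, mahalSlope, resid, loc_single_inr, Matrix.transpose_apply]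
    simp [Finset.mul_sum]
    refine Finset.sum_congr rfl fun n _ => ?_
    ring
  · rw [hf]
    simp only [JPP_apply, Matrix.fromBlocks_apply₂₂, Matrix.neg_apply, mahalSlope, resid,
      loc_single_inr]
    simp [Finset.mul_sum]
    refine Finset.sum_congr rfl fun n _ => ?_
    ring

end ClusteredData

/-! ### Determinant of the Fisher information matrix and value of the likelihood -/

theorem sq_dotProduct_mulVec_le {n : Type*} [Fintype n] {P : Matrix n n ℝ} (hP : P.PosSemidef)
    (x y : n → ℝ) : (x ⬝ᵥ P *ᵥ y) ^ 2 ≤ (x ⬝ᵥ P *ᵥ x) * (y ⬝ᵥ P *ᵥ y) := by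
  have hT : Pᵀ = P := hP.isHermitian.eq
  have h (t : ℝ) : 0 ≤ (y ⬝ᵥ P *ᵥ y) * (t * t) + 2 * (x ⬝ᵥ P *ᵥ y) * t + x ⬝ᵥ P *ᵥ x := by
    have := hP.dotProduct_mulVec_nonneg (x + t • y)
    simp only [star_trivial, Matrix.mulVec_add, Matrix.mulVec_smul, add_dotProduct,
      dotProduct_add, smul_dotProduct, dotProduct_smul, smul_eq_mul] at this
    rw [dotProduct_mulVec_comm_of_transpose hT y x] at this
    linarith
  have := discrim_le_zero h
  rw [discrim] at this
  linarith

theorem trace_mul_mul_mul_pos {n : Type*} [Fintype n] [DecidableEq n] {P U : Matrix n n ℝ}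
    (hP : P.PosDef) (hU : Uᵀ = U) (h0 : U ≠ 0) : 0 < (P * U * P * U).trace := by
  have hT : Pᵀ = P := hP.isHermitian.eq
  have h := (hP.kronecker hP).dotProduct_mulVec_pos (x := U.vec)
    (by simpa [Matrix.vec_eq_zero_iff] using h0)
  rw [star_trivial, Matrix.kronecker_mulVec_vec, Matrix.vec_dotProduct_vec, hU, hT,
    Matrix.trace_mul_comm] at h
  exact h

namespace ClusteredData

variable {r : ℕ} {M : ModelFamily r} {N : ℕ} (S : ClusteredData M N) {l : M.Idx}

section MLE

variable (h : S.IsMLE l) (hl : Function.Surjective (S.label l)) (m : Fin l.1)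
include h

theorem weight_mul_sq_le (n : Fin N) {U : Matrix (Fin r) (Fin r) ℝ} (hU : Uᵀ = U) :
    1 / (M.ν l m + r) * (S.w l m n ^ 2 * (S.resid m n ⬝ᵥ U *ᵥ S.resid m n) ^ 2) ≤
      S.w l m n * (S.resid m n ⬝ᵥ (U * S.prec l m * U) *ᵥ S.resid m n)
        - M.ν l m / (M.ν l m + mahal (S.est l m) (S.x n)) *
          (S.w l m n * (S.resid m n ⬝ᵥ (U * S.prec l m * U) *ᵥ S.resid m n)) := by
  have hp := S.est_posDef h.1 m
  have hν := M.ν_pos l m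
  have hδ := mahal_nonneg hp (S.x n)
  have hcs := sq_dotProduct_mulVec_le hp.inv.posSemidef (centred (S.est l m) (S.x n))
    (U *ᵥ S.resid m n)
  have h1 : centred (S.est l m) (S.x n) ⬝ᵥ (scat (S.est l m))⁻¹ *ᵥ U *ᵥ S.resid m n =
      S.resid m n ⬝ᵥ U *ᵥ S.resid m n := by
    rw [dotProduct_mulVec_comm_of_transpose (inv_scat_transpose _), dotProduct_comm]
    rfl
  have h2 : (U *ᵥ S.resid m n) ⬝ᵥ (scat (S.est l m))⁻¹ *ᵥ U *ᵥ S.resid m n =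
      S.resid m n ⬝ᵥ (U * S.prec l m * U) *ᵥ S.resid m n := by
    rw [← Matrix.mulVec_mulVec, ← Matrix.mulVec_mulVec, dotProduct_comm,
      dotProduct_mulVec_comm_of_transpose hU]
    rfl
  rw [h1, h2] at hcs
  set q := S.resid m n ⬝ᵥ (U * S.prec l m * U) *ᵥ S.resid m n
  set p := S.resid m n ⬝ᵥ U *ᵥ S.resid m n
  change p ^ 2 ≤ mahal (S.est l m) (S.x n) * q at hcs
  simp only [w, weight]
  set δ := mahal (S.est l m) (S.x n)
  have hr : 0 < M.ν l m + r := by positivity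
  have hd : 0 < M.ν l m + δ := by positivity
  calc _ = (M.ν l m + r) / (M.ν l m + δ) ^ 2 * p ^ 2 := by field_simp
    _ ≤ (M.ν l m + r) / (M.ν l m + δ) ^ 2 * (δ * q) := by gcongr
    _ = _ := by field_simp; ring

include hl

theorem dotProduct_JPP_mulVec_neg {z : Sym2 (Fin r) → ℝ} (hz : z ≠ 0) :
    z ⬝ᵥ S.JPP l m *ᵥ z < 0 := by
  have hp := S.est_posDef h.1 m
  have hν := M.ν_pos l m
  have hr : 0 < M.ν l m + r := by positivity
  have hN : 0 < (S.size l m : ℝ) := by exact_mod_cast S.size_pos_of_surjective l hl m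
  set u : Par r := Sum.elim 0 z with hu
  set U := scat u with hUdef
  have hU : Uᵀ = U := scat_transpose u
  have hU0 : U ≠ 0 := by
    contrapose! hz
    ext s
    induction s with
    | _ i j => exact congrFun (congrFun hz i) j
  have hquad := S.dotProduct_JPP_mulVec m u u
  change z ⬝ᵥ S.JPP l m *ᵥ z = _ at hquad
  set T := (S.prec l m * U * S.prec l m * U).trace with hT
  have hTpos : 0 < T := trace_mul_mul_mul_pos hp.inv hU hU0
  have hsum : ∑ n ∈ S.cluster l m, S.w l m n *
      (S.resid m n ⬝ᵥ (U * S.prec l m * U) *ᵥ S.resid m n) = S.size l m * T := by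
    rw [S.sum_weight_quadratic h m, hT]
    simp only [Matrix.mul_assoc]
  have hq (n : Fin N) : 0 ≤ S.w l m n *
      (S.resid m n ⬝ᵥ (U * S.prec l m * U) *ᵥ S.resid m n) := by
    have hδ := mahal_nonneg hp (S.x n)
    refine mul_nonneg (by rw [w, weight]; positivity) ?_
    have := hp.inv.posSemidef.conjTranspose_mul_mul_same U
    rw [Matrix.conjTranspose_eq_transpose_of_trivial, hU] at this
    exact this.dotProduct_mulVec_nonneg (S.resid m n)
  obtain ⟨n₀, hn₀, hpos⟩ : ∃ n ∈ S.cluster l m, 0 < S.w l m n *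
      (S.resid m n ⬝ᵥ (U * S.prec l m * U) *ᵥ S.resid m n) := by
    by_contra! hcon
    have := Finset.sum_nonpos hcon
    rw [hsum] at this
    exact absurd this (not_le.2 (by positivity))
  have hlt : 1 / (M.ν l m + r) * ∑ n ∈ S.cluster l m, S.w l m n ^ 2 *
      (S.resid m n ⬝ᵥ U *ᵥ S.resid m n) ^ 2 < S.size l m * T := by
    rw [← hsum, Finset.mul_sum]
    have hf (n : Fin N) : 0 < M.ν l m / (M.ν l m + mahal (S.est l m) (S.x n)) := by
      have hδ := mahal_nonneg hp (S.x n)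
      positivity
    refine Finset.sum_lt_sum (fun n _ => ?_) ⟨n₀, hn₀, ?_⟩
    · have := S.weight_mul_sq_le h m n hU
      have := mul_nonneg (hf n).le (hq n)
      linarith
    · have := S.weight_mul_sq_le h m n₀ hU
      have := mul_pos (hf n₀) hpos
      linarith
  rw [hquad]
  have h2 : 1 / (2 * (M.ν l m + r)) * ∑ n ∈ S.cluster l m, S.w l m n ^ 2 *
        ((S.resid m n ⬝ᵥ U *ᵥ S.resid m n) * (S.resid m n ⬝ᵥ U *ᵥ S.resid m n)) =
      1 / 2 * (1 / (M.ν l m + r) * ∑ n ∈ S.cluster l m, S.w l m n ^ 2 *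
        (S.resid m n ⬝ᵥ U *ᵥ S.resid m n) ^ 2) := by
    simp only [sq (_ ⬝ᵥ _)]
    field_simp
  rw [h2]
  linarith

theorem isUnit_det_JPP : IsUnit (S.JPP l m).det := by
  rw [isUnit_iff_ne_zero]
  intro h0
  obtain ⟨z, hz, hz'⟩ := Matrix.exists_mulVec_eq_zero_iff.2 h0
  have := S.dotProduct_JPP_mulVec_neg h hl m hz
  rw [hz'] at this
  simp at this

theorem det_fim : (S.fim l m).det = S.schurDet l m := by
  have hu := S.isUnit_det_JPP h hl m
  have hu' : IsUnit (-S.JPP l m) := ((Matrix.isUnit_iff_isUnit_det _).2 hu).neg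
  have := hu'.invertible
  have hinv : (-S.JPP l m)⁻¹ = -(S.JPP l m)⁻¹ :=
    Matrix.inv_eq_left_inv (by rw [neg_mul_neg, Matrix.nonsing_inv_mul _ hu])
  rw [S.fim_eq_fromBlocks m h, Matrix.det_fromBlocks₂₂, schurDet, mul_comm, Matrix.invOf_eq_nonsing_inv,
    hinv]
  congr 2
  simp [Matrix.mul_assoc]

end MLE

theorem logLik_eq_fidelity (hl : Function.Surjective (S.label l))
    (hp : ∀ m, (scat (S.est l m)).PosDef) :
    S.logLik l (S.est l) = S.fidelity l - N * Real.log N := by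
  have h1 (m : Fin l.1) : Real.log (S.clusterLik l m (S.est l m)) =
      S.size l m * Real.log (S.size l m) - S.size l m / 2 * Real.log (scat (S.est l m)).det
      + S.size l m * Real.log (tNorm r (M.ν l m))
      - 1 / 2 * ∑ n ∈ S.cluster l m,
        (M.ν l m + r) * Real.log (1 + mahal (S.est l m) (S.x n) / M.ν l m)
      - S.size l m * Real.log N := by
    have hs := S.size_pos_of_surjective l hl m
    have hN := hs.trans_le (S.size_le l m)
    rw [S.log_clusterLik l (hp m)]
    simp_rw [log_tPdf (M.ν_pos l m) (hp m)]
    rw [Real.log_div (by positivity) (by positivity)]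
    simp only [Finset.sum_add_distrib, Finset.sum_sub_distrib, Finset.sum_const, nsmul_eq_mul,
      Finset.mul_sum]
    rw [show (S.cluster l m).card = S.size l m from rfl]
    have : ∑ n ∈ S.cluster l m, (M.ν l m + r) / 2 *
          Real.log (1 + mahal (S.est l m) (S.x n) / M.ν l m) =
        ∑ n ∈ S.cluster l m, 1 / 2 * ((M.ν l m + r) *
          Real.log (1 + mahal (S.est l m) (S.x n) / M.ν l m)) :=
      Finset.sum_congr rfl fun n _ => by ring
    rw [this]
    ring
  have h2 : (N : ℝ) = ∑ m, (S.size l m : ℝ) := by rw [← Nat.cast_sum, S.sum_size]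
  rw [S.logLik_eq_sum l hp]
  simp_rw [h1]
  conv_rhs => rw [show (N : ℝ) * Real.log N = ∑ m, (S.size l m : ℝ) * Real.log N by
    rw [← Finset.sum_mul, ← h2]]
  simp only [fidelity, Finset.sum_add_distrib, Finset.sum_sub_distrib, ← Finset.mul_sum]

end ClusteredData

/-! ### Gaussian integrals -/

section Gaussian

variable {ι κ : Type*} [Fintype ι] [Fintype κ]

theorem integral_exp_neg_half_dotProduct_self :
    ∫ x : ι → ℝ, Real.exp (-(1 / 2) * (x ⬝ᵥ x)) =
      (2 * Real.pi) ^ ((Fintype.card ι : ℝ) / 2) := by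
  have h (x : ι → ℝ) : Real.exp (-(1 / 2) * (x ⬝ᵥ x)) =
      ∏ i, Real.exp (-(1 / 2) * x i ^ 2) := by
    rw [← Real.exp_sum, dotProduct, Finset.mul_sum]
    simp only [sq]
  simp_rw [h]
  rw [integral_fintype_prod_volume_eq_pow (fun t : ℝ => Real.exp (-(1 / 2) * t ^ 2)),
    integral_gaussian, show Real.pi / (1 / 2) = 2 * Real.pi by ring, Real.sqrt_eq_rpow,
    ← Real.rpow_natCast, ← Real.rpow_mul (by positivity)]
  congr 1
  ring

/-- The block diagonal quadratic form with blocks `J`. -/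
def blockForm (J : κ → Matrix ι ι ℝ) (V : κ → ι → ℝ) : ℝ := ∑ m, V m ⬝ᵥ J m *ᵥ V m

theorem blockForm_nonneg {J : κ → Matrix ι ι ℝ} (hJ : ∀ m, (J m).PosDef) (V : κ → ι → ℝ) : 0 ≤ blockForm J V :=
  Finset.sum_nonneg fun m _ => by simpa using (hJ m).posSemidef.dotProduct_mulVec_nonneg (V m)

variable [DecidableEq ι]

open scoped MatrixOrder in
theorem Matrix.PosDef.exists_eq_transpose_mul_self {J : Matrix ι ι ℝ} (hJ : J.PosDef) :
    ∃ B : Matrix ι ι ℝ, J = Bᵀ * B := by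
  refine ⟨CFC.sqrt J, ?_⟩
  have h := (Matrix.nonneg_iff_posSemidef.1 (CFC.sqrt_nonneg J)).isHermitian.eq
  rw [Matrix.conjTranspose_eq_transpose_of_trivial] at h
  rw [h, CFC.sqrt_mul_sqrt_self J hJ.posSemidef.nonneg]

theorem integral_exp_neg_half_posDef {J : Matrix ι ι ℝ} (hJ : J.PosDef) :
    ∫ x : ι → ℝ, Real.exp (-(1 / 2) * (x ⬝ᵥ J *ᵥ x)) =
      (2 * Real.pi) ^ ((Fintype.card ι : ℝ) / 2) / √J.det := by
  obtain ⟨B, rfl⟩ := hJ.exists_eq_transpose_mul_self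
  have hdet : (Bᵀ * B).det = B.det ^ 2 := by rw [Matrix.det_mul, Matrix.det_transpose, sq]
  have hB : B.det ≠ 0 := fun h0 => hJ.det_pos.ne' (by rw [hdet, h0]; simp)
  have h (x : ι → ℝ) : x ⬝ᵥ (Bᵀ * B) *ᵥ x = Matrix.toLin' B x ⬝ᵥ Matrix.toLin' B x := by
    rw [← Matrix.mulVec_mulVec, Matrix.dotProduct_mulVec, Matrix.vecMul_transpose]
    rfl
  have hc : Continuous fun x : ι → ℝ => Real.exp (-(1 / 2) * (x ⬝ᵥ x)) := by
    simp only [dotProduct]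
    fun_prop
  have hmap := integral_map (μ := volume) (φ := Matrix.toLin' B)
    (LinearMap.continuous_on_pi _).measurable.aemeasurable
    (f := fun x : ι → ℝ => Real.exp (-(1 / 2) * (x ⬝ᵥ x))) hc.aestronglyMeasurable
  simp_rw [h]
  rw [← hmap, Real.map_matrix_volume_pi_eq_smul_volume_pi hB, integral_smul_measure,
    integral_exp_neg_half_dotProduct_self, hdet, Real.sqrt_sq_eq_abs, abs_inv,
    ENNReal.toReal_ofReal (by positivity), smul_eq_mul]
  exact (mul_comm _ _).trans (div_eq_mul_inv _ _).symm

/-- The integral of `exp (-Q / 2)` for the block diagonal quadratic form with blocks `J`. -/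
def gaussMass (J : κ → Matrix ι ι ℝ) : ℝ :=
  ∏ m, (2 * Real.pi) ^ ((Fintype.card ι : ℝ) / 2) / √(J m).det

variable {J : κ → Matrix ι ι ℝ} (hJ : ∀ m, (J m).PosDef)

include hJ

theorem gaussMass_pos : 0 < gaussMass J := by
  refine Finset.prod_pos fun m _ => ?_
  have := (hJ m).det_pos
  positivity

theorem integral_exp_neg_blockForm {t : ℝ} (ht : 0 < t) :
    ∫ V : κ → ι → ℝ, Real.exp (-(t / 2) * blockForm J V) =
      t ^ (-((Fintype.card κ * Fintype.card ι : ℝ) / 2)) * gaussMass J := by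
  have h (V : κ → ι → ℝ) : Real.exp (-(t / 2) * blockForm J V) =
      ∏ m, Real.exp (-(1 / 2) * (V m ⬝ᵥ (t • J m) *ᵥ V m)) := by
    rw [← Real.exp_sum, ← Finset.mul_sum, blockForm]
    simp only [Matrix.smul_mulVec, dotProduct_smul, smul_eq_mul, ← Finset.mul_sum]
    congr 1
    ring
  simp_rw [h]
  rw [integral_fintype_prod_volume_eq_prod
    (fun (m : κ) (x : ι → ℝ) => Real.exp (-(1 / 2) * (x ⬝ᵥ (t • J m) *ᵥ x)))]
  have h2 (m : κ) : ∫ x : ι → ℝ, Real.exp (-(1 / 2) * (x ⬝ᵥ (t • J m) *ᵥ x)) =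
      t ^ (-((Fintype.card ι : ℝ) / 2)) *
        ((2 * Real.pi) ^ ((Fintype.card ι : ℝ) / 2) / √(J m).det) := by
    have hd := (hJ m).det_pos
    rw [integral_exp_neg_half_posDef ((hJ m).smul ht), Matrix.det_smul,
      Real.sqrt_mul (by positivity), Real.rpow_neg ht.le, Real.sqrt_eq_rpow (t ^ _),
      ← Real.rpow_natCast, ← Real.rpow_mul ht.le, mul_one_div]
    field_simp
  simp_rw [h2]
  rw [Finset.prod_mul_distrib, Finset.prod_const, ← Real.rpow_natCast, ← Real.rpow_mul ht.le]
  congr 2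
  simp
  ring

theorem integrable_exp_neg_blockForm {t : ℝ} (ht : 0 < t) :
    Integrable fun V : κ → ι → ℝ => Real.exp (-(t / 2) * blockForm J V) := by
  refine Integrable.of_integral_ne_zero ?_
  rw [integral_exp_neg_blockForm hJ ht]
  have := gaussMass_pos hJ
  positivity

theorem log_gaussMass : Real.log (gaussMass J) =
    (Fintype.card κ : ℝ) * Fintype.card ι / 2 * Real.log (2 * Real.pi)
      - 1 / 2 * ∑ m, Real.log (J m).det := by
  rw [gaussMass, Real.log_prod fun m _ => by have := (hJ m).det_pos; positivity]
  have h (m : κ) : Real.log ((2 * Real.pi) ^ ((Fintype.card ι : ℝ) / 2) / √(J m).det) =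
      (Fintype.card ι : ℝ) / 2 * Real.log (2 * Real.pi) - 1 / 2 * Real.log (J m).det := by
    have := (hJ m).det_pos
    rw [Real.log_div (by positivity) (by positivity), Real.log_rpow (by positivity),
      Real.log_sqrt this.le]
    ring
  simp_rw [h]
  rw [Finset.sum_sub_distrib, Finset.sum_const, ← Finset.mul_sum, nsmul_eq_mul, Finset.card_univ]
  ring

end Gaussian

theorem card_parIdx (r : ℕ) : (Fintype.card (ParIdx r) : ℝ) = numPar r := by
  rw [Fintype.card_sum, Sym2.card, Fintype.card_fin, numPar, Nat.cast_add, Nat.cast_choose_two]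
  push_cast
  ring

/-! ### The Laplace approximation of the posterior -/

theorem apply_apply_eq_dotProduct_mulVec {ι : Type*} [Fintype ι] [DecidableEq ι]
    (B : (ι → ℝ) →L[ℝ] (ι → ℝ) →L[ℝ] ℝ) (u v : ι → ℝ) :
    B u v = u ⬝ᵥ (Matrix.of fun i j => B (Pi.single i 1) (Pi.single j 1)) *ᵥ v := by
  have hu : u = ∑ i, u i • Pi.single i (1 : ℝ) := pi_eq_sum_univ' u
  have hv : v = ∑ i, v i • Pi.single i (1 : ℝ) := pi_eq_sum_univ' v
  conv_lhs => rw [hu, hv]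
  simp only [map_sum, map_smul, sum_apply, smul_apply, smul_eq_mul, dotProduct, Matrix.mulVec,
    Matrix.of_apply, Finset.mul_sum]
  rw [Finset.sum_comm]
  refine Finset.sum_congr rfl fun i _ => Finset.sum_congr rfl fun j _ => ?_
  ring

namespace ClusteredData

variable {r : ℕ} {M : ModelFamily r} {N : ℕ} (S : ClusteredData M N) {l : M.Idx}

theorem fderiv_fderiv_clusterLogLik_apply (m : Fin l.1) (v : Par r) :
    fderiv ℝ (fderiv ℝ (S.clusterLogLik l m)) (S.est l m) v v = -(v ⬝ᵥ S.fim l m *ᵥ v) := by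
  rw [apply_apply_eq_dotProduct_mulVec, fim, Matrix.neg_mulVec, dotProduct_neg, neg_neg]
  rfl

theorem taylorTwo_logLik (h : S.IsMLE l) (Θ : Fin l.1 → Par r) :
    taylorTwo (S.logLik l) (S.est l) Θ =
      S.logLik l (S.est l) - 1 / 2 * blockForm (S.fim l) (Θ - S.est l) := by
  have hΩ : ∀ᶠ Θ in 𝓝 (S.est l), Θ ∈ M.Ω l := mem_interior_iff_mem_nhds.1 h.1
  have hint : ∀ᶠ Θ in 𝓝 (S.est l), ∀ m, ∀ᶠ θ in 𝓝 (Θ m), (scat θ).PosDef := by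
    refine eventually_all.2 fun m => ?_
    exact (continuous_apply m).continuousAt.eventually
      (S.eventually_posDef h.1 m).eventually_nhds
  have h0 : S.logLik l =ᶠ[𝓝 (S.est l)] fun Θ => ∑ m, S.clusterLogLik l m (Θ m) :=
    hΩ.mono fun Θ h => S.logLik_eq_sum l (M.Ω_posDef l Θ h)
  have h1 : fderiv ℝ (S.logLik l) =ᶠ[𝓝 (S.est l)] fun Θ => ∑ m,
      (fderiv ℝ (S.clusterLogLik l m) (Θ m)).comp
        (ContinuousLinearMap.proj (R := ℝ) (φ := fun _ : Fin l.1 => Par r) m) := by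
    filter_upwards [h0.eventuallyEq_nhds, hint] with Θ hΘ hp
    rw [hΘ.fderiv_eq]
    refine (HasFDerivAt.fun_sum fun m _ => ?_).fderiv
    exact ((S.contDiffAt_clusterLogLik (k := 1) l (hp m)).differentiableAt
      (by simp)).hasFDerivAt.comp Θ (ContinuousLinearMap.proj (R := ℝ)
        (φ := fun _ : Fin l.1 => Par r) m).hasFDerivAt
  have h2 : HasFDerivAt (fun Θ : Fin l.1 → Par r => ∑ m,
      (fderiv ℝ (S.clusterLogLik l m) (Θ m)).comp
        (ContinuousLinearMap.proj (R := ℝ) (φ := fun _ : Fin l.1 => Par r) m)) _ (S.est l) :=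
    HasFDerivAt.fun_sum fun m _ => by
      have hd : DifferentiableAt ℝ (fderiv ℝ (S.clusterLogLik l m)) (S.est l m) :=
        ((S.contDiffAt_clusterLogLik (k := 2) l (S.eventually_posDef h.1 m)).fderiv_right
          (m := 1) (by norm_num)).differentiableAt (by simp)
      exact (hd.hasFDerivAt.comp (S.est l) (ContinuousLinearMap.proj (R := ℝ)
        (φ := fun _ : Fin l.1 => Par r) m).hasFDerivAt).clm_comp (hasFDerivAt_const _ _)
  rw [taylorTwo, h1.self_of_nhds, h1.fderiv_eq, h2.fderiv]
  generalize Θ - S.est l = V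
  simp only [S.fderiv_clusterLogLik_est h, sum_apply]
  simp [S.fderiv_fderiv_clusterLogLik_apply, blockForm]
  ring

variable (h : S.IsMLE l) (hJ : ∀ m, (S.fim l m).PosDef)
include h hJ

theorem laplaceEvidence_eq : S.laplaceEvidence l =
    M.f l (S.est l) * Real.exp (S.logLik l (S.est l)) * gaussMass (S.fim l) := by
  rw [laplaceEvidence, integral_const_mul, mul_assoc]
  congr 1
  simp_rw [S.taylorTwo_logLik h, sub_eq_add_neg (S.logLik l _), Real.exp_add]
  rw [integral_const_mul]
  congr 1
  rw [integral_sub_right_eq_self (fun V => Real.exp (-(1 / 2 * blockForm (S.fim l) V)))]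
  have := integral_exp_neg_blockForm hJ one_pos
  simpa using this

theorem laplacePosterior_pos_and_log (hf : 0 < M.f l (S.est l)) (hm : 0 < S.marginal) :
    0 < S.laplacePosterior l ∧
      Real.log (S.laplacePosterior l) = S.logPosteriorExpansion l := by
  have hG := gaussMass_pos hJ
  have hp := M.p_pos l
  rw [laplacePosterior, S.laplaceEvidence_eq h hJ]
  refine ⟨by positivity, ?_⟩
  rw [Real.log_div (by positivity) hm.ne', Real.log_mul hp.ne' (by positivity),
    Real.log_mul (by positivity) hG.ne', Real.log_mul hf.ne' (Real.exp_pos _).ne', Real.log_exp,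
    log_gaussMass hJ, card_parIdx, Fintype.card_fin, logPosteriorExpansion]
  ring

end ClusteredData

/-! ### Second-order Taylor expansion with a uniform remainder -/

theorem abs_sub_taylorTwo_le {E : Type*} [NormedAddCommGroup E] [NormedSpace ℝ E] {f : E → ℝ}
    {a : E} {d ε : ℝ} (hε : 0 ≤ ε) (hf : ∀ y ∈ Metric.ball a d, ContDiffAt ℝ 2 f y)
    (hD : ∀ y ∈ Metric.ball a d,
      ‖fderiv ℝ (fderiv ℝ f) y - fderiv ℝ (fderiv ℝ f) a‖ ≤ ε)
    {y : E} (hy : y ∈ Metric.ball a d) :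
    |f y - taylorTwo f a y| ≤ ε * ‖y - a‖ ^ 2 := by
  have ha : a ∈ Metric.ball a d := Metric.mem_ball_self (dist_nonneg.trans_lt hy)
  set B := fderiv ℝ (fderiv ℝ f) a with hB
  have hsymm : ∀ u v, B u v = B v u := (hf a ha).isSymmSndFDerivAt (by simp)
  have h1 (z : E) (hz : z ∈ Metric.ball a d) :
      ‖fderiv ℝ f z - fderiv ℝ f a - B (z - a)‖ ≤ ε * ‖z - a‖ := by
    have hd (w : E) (hw : w ∈ Metric.ball a d) : HasFDerivWithinAt
        (fun w => fderiv ℝ f w - fderiv ℝ f a - B (w - a))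
        (fderiv ℝ (fderiv ℝ f) w - B) (Metric.ball a d) w := by
      have h2 : DifferentiableAt ℝ (fderiv ℝ f) w :=
        ((hf w hw).fderiv_right (m := 1) (by norm_num)).differentiableAt (by simp)
      have h3 : HasFDerivAt (fun w => B (w - a)) B w := by
        exact B.hasFDerivAt.comp w ((hasFDerivAt_id w).sub_const a)
      exact ((h2.hasFDerivAt.sub_const _).fun_sub h3).hasFDerivWithinAt
    have := (convex_ball a d).norm_image_sub_le_of_norm_hasFDerivWithin_le hd hD ha hz
    simpa using this
  have h4 (z : E) (hz : z ∈ Metric.ball a d) :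
      HasFDerivAt (fun w => f w - taylorTwo f a w) (fderiv ℝ f z - fderiv ℝ f a - B (z - a)) z := by
    have h5 : HasFDerivAt f (fderiv ℝ f z) z :=
      ((hf z hz).differentiableAt (by simp)).hasFDerivAt
    have hs : HasFDerivAt (fun w => w - a) (ContinuousLinearMap.id ℝ E) z :=
      (hasFDerivAt_id z).sub_const a
    have h6 := (fderiv ℝ f a).hasFDerivAt.comp z hs
    have h7 := ((B.hasFDerivAt.comp z hs).clm_apply hs).const_mul (1 / 2)
    refine (h5.fun_sub ((h6.const_add (f a)).fun_add h7)).congr_fderiv ?_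
    ext v
    simp [hsymm v]
    ring
  have hsub : Metric.closedBall a ‖y - a‖ ⊆ Metric.ball a d :=
    Metric.closedBall_subset_ball (by simpa [dist_eq_norm] using hy)
  have := (convex_closedBall a ‖y - a‖).norm_image_sub_le_of_norm_hasFDerivWithin_le
    (C := ε * ‖y - a‖) (x := a) (y := y)
    (fun z hz => (h4 z (hsub hz)).hasFDerivWithinAt) (fun z hz => (h1 z (hsub hz)).trans
      (mul_le_mul_of_nonneg_left (by simpa [dist_eq_norm] using hz) hε))
    (Metric.mem_closedBall_self (norm_nonneg _)) (by simp [dist_eq_norm])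
  have ht : taylorTwo f a a = f a := by simp [taylorTwo]
  rw [ht, sub_self, sub_zero, Real.norm_eq_abs] at this
  calc _ ≤ _ := this
    _ = _ := by ring

section Uniform

variable {r : ℕ} {ν : ℝ} (hν : 0 < ν)
include hν

theorem continuousAt_fderiv_fderiv_logCore {s : ℝ × (Fin r → ℝ)} (hs : s ≠ 0) {θ : Par r}
    (h : (scat θ).PosDef) :
    ContinuousAt (fun p : (ℝ × (Fin r → ℝ)) × Par r =>
      fderiv ℝ (fderiv ℝ (logCore ν p.1)) p.2) (s, θ) := by
  have h0 : ContDiffAt ℝ ((2 : ℕ∞) : WithTop ℕ∞) (Function.uncurry (logCore (r := r) ν)) (s, θ) :=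
    contDiffAt_uncurry_logCore hν hs h
  have h1 : ContDiffAt ℝ 1 (fun p : (ℝ × (Fin r → ℝ)) × Par r =>
      fderiv ℝ (logCore ν p.1) p.2) (s, θ) := by
    refine ContDiffAt.fderiv (n := ((2 : ℕ∞) : WithTop ℕ∞)) ?_ contDiffAt_snd (by norm_num)
    exact ContDiffAt.comp (g := Function.uncurry (logCore (r := r) ν))
      (f := fun q : ((ℝ × (Fin r → ℝ)) × Par r) × Par r => (q.1.1, q.2)) _ h0 (by fun_prop)
  have h2 : ContDiffAt ℝ 0 (fun p : (ℝ × (Fin r → ℝ)) × Par r =>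
      fderiv ℝ (fderiv ℝ (logCore ν p.1)) p.2) (s, θ) := by
    refine ContDiffAt.fderiv (n := 1) ?_ contDiffAt_snd (by norm_num)
    exact ContDiffAt.comp
      (g := fun p : (ℝ × (Fin r → ℝ)) × Par r => fderiv ℝ (logCore ν p.1) p.2)
      (f := fun q : ((ℝ × (Fin r → ℝ)) × Par r) × Par r => (q.1.1, q.2)) _ h1 (by fun_prop)
  exact h2.continuousAt

variable {K : Set (Par r)} (hK : IsCompact K) (hp : ∀ θ ∈ K, (scat θ).PosDef)
include hp

theorem continuousOn_fderiv_fderiv_logCore :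
    ContinuousOn (fun p : (ℝ × (Fin r → ℝ)) × Par r =>
      fderiv ℝ (fderiv ℝ (logCore ν p.1)) p.2) (Metric.sphere 0 1 ×ˢ K) := fun p hq =>
  (continuousAt_fderiv_fderiv_logCore hν (ne_zero_of_mem_unit_sphere ⟨p.1, hq.1⟩)
    (hp p.2 hq.2)).continuousWithinAt

include hK

theorem exists_norm_fderiv_fderiv_logCore_le :
    ∃ C, ∀ s ∈ Metric.sphere (0 : ℝ × (Fin r → ℝ)) 1, ∀ θ ∈ K,
      ‖fderiv ℝ (fderiv ℝ (logCore ν s)) θ‖ ≤ C := by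
  obtain ⟨C, hC⟩ := ((isCompact_sphere (0 : ℝ × (Fin r → ℝ)) 1).prod hK).exists_bound_of_continuousOn
    (E := Par r →L[ℝ] Par r →L[ℝ] ℝ)
    (continuousOn_fderiv_fderiv_logCore hν hp)
  exact ⟨C, fun s hs θ hθ => hC (s, θ) ⟨hs, hθ⟩⟩

theorem exists_norm_fderiv_fderiv_logCore_sub_le {ε : ℝ} (hε : 0 < ε) :
    ∃ d > 0, ∀ s ∈ Metric.sphere (0 : ℝ × (Fin r → ℝ)) 1, ∀ θ ∈ K, ∀ η ∈ K, dist η θ < d →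
      ‖fderiv ℝ (fderiv ℝ (logCore ν s)) η - fderiv ℝ (fderiv ℝ (logCore ν s)) θ‖ ≤ ε := by
  have huc := ((isCompact_sphere (0 : ℝ × (Fin r → ℝ)) 1).prod hK).uniformContinuousOn_of_continuous
    (β := Par r →L[ℝ] Par r →L[ℝ] ℝ)
    (continuousOn_fderiv_fderiv_logCore hν hp)
  obtain ⟨d, hd, h⟩ := (Metric.uniformContinuousOn_iff (α := (ℝ × (Fin r → ℝ)) × Par r)
    (β := Par r →L[ℝ] Par r →L[ℝ] ℝ)).1 huc ε hε
  refine ⟨d, hd, fun s hs θ hθ η hη hdist => ?_⟩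
  have := h (s, η) ⟨hs, hη⟩ (s, θ) ⟨hs, hθ⟩ (by simpa [Prod.dist_eq] using hdist)
  exact (dist_eq_norm (fderiv ℝ (fderiv ℝ (logCore ν s)) η) _).symm.trans_le this.le

end Uniform

theorem fderiv_fderiv_logCore_normalize {r : ℕ} {ν : ℝ} (hν : 0 < ν) {a : Par r}
    (ha : ∀ᶠ θ in 𝓝 a, (scat θ).PosDef) {s : ℝ × (Fin r → ℝ)} (hs : s ≠ 0) :
    fderiv ℝ (fderiv ℝ (logCore ν s)) a = fderiv ℝ (fderiv ℝ (logCore ν (‖s‖⁻¹ • s))) a := by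
  have hs' : 0 < ‖s‖⁻¹ := inv_pos.2 (norm_pos_iff.2 hs)
  have h1 : logCore ν (‖s‖⁻¹ • s) =ᶠ[𝓝 a]
      fun θ => logCore ν s θ - (ν + r) * Real.log ‖s‖⁻¹ :=
    ha.mono fun θ h => logCore_smul hν hs' hs h
  rw [h1.fderiv.fderiv_eq]
  congr 1
  ext1 θ
  rw [fderiv_sub_const]

namespace ClusteredData

variable {r : ℕ} {M : ModelFamily r} {l : M.Idx} (m : Fin l.1)
  {K : Set (Par r)} (hK : IsCompact K) (hp : ∀ θ ∈ K, ∀ᶠ η in 𝓝 θ, (scat η).PosDef)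
include hK hp

theorem exists_norm_fderiv_fderiv_clusterLogLik_le :
    ∃ C, ∀ (N : ℕ) (S : ClusteredData M N), ∀ θ ∈ K,
      ‖fderiv ℝ (fderiv ℝ (S.clusterLogLik l m)) θ‖ ≤ S.size l m * C := by
  obtain ⟨C, hC⟩ := exists_norm_fderiv_fderiv_logCore_le (M.ν_pos l m) hK
    fun θ hθ => (hp θ hθ).self_of_nhds
  refine ⟨C, fun N S θ hθ => ?_⟩
  rw [S.fderiv_fderiv_clusterLogLik l (hp θ hθ)]
  refine (norm_sum_le_of_le (E := Par r →L[ℝ] Par r →L[ℝ] ℝ) _ fun n _ => ?_).trans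
    (by simp [size] : ∑ _ ∈ S.cluster l m, C ≤ S.size l m * C)
  have hs : ((1 : ℝ), S.x n) ≠ 0 := by simp
  rw [fderiv_fderiv_logCore_normalize (M.ν_pos l m) (hp θ hθ) hs]
  exact hC _ (by simpa using norm_smul_inv_norm (𝕜 := ℝ) hs) θ hθ

theorem exists_norm_fderiv_fderiv_clusterLogLik_sub_le {ε : ℝ} (hε : 0 < ε) :
    ∃ d > 0, ∀ (N : ℕ) (S : ClusteredData M N), ∀ θ ∈ K, ∀ η ∈ K, dist η θ < d →
      ‖fderiv ℝ (fderiv ℝ (S.clusterLogLik l m)) η - fderiv ℝ (fderiv ℝ (S.clusterLogLik l m)) θ‖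
        ≤ S.size l m * ε := by
  obtain ⟨d, hd, h⟩ := exists_norm_fderiv_fderiv_logCore_sub_le (M.ν_pos l m) hK
    (fun θ hθ => (hp θ hθ).self_of_nhds) hε
  refine ⟨d, hd, fun N S θ hθ η hη hdist => ?_⟩
  rw [S.fderiv_fderiv_clusterLogLik l (hp θ hθ), S.fderiv_fderiv_clusterLogLik l (hp η hη)]
  have hsub := Finset.sum_sub_distrib (s := S.cluster l m)
    (fun n => fderiv ℝ (fderiv ℝ (logCore (M.ν l m) (1, S.x n))) η)
    (fun n => fderiv ℝ (fderiv ℝ (logCore (M.ν l m) (1, S.x n))) θ)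
  refine (congrArg norm hsub.symm).trans_le ?_
  refine (norm_sum_le_of_le (E := Par r →L[ℝ] Par r →L[ℝ] ℝ) _ fun n _ => ?_).trans
    (by simp [size] : ∑ _ ∈ S.cluster l m, ε ≤ S.size l m * ε)
  have hs : ((1 : ℝ), S.x n) ≠ 0 := by simp
  rw [fderiv_fderiv_logCore_normalize (M.ν_pos l m) (hp θ hθ) hs,
    fderiv_fderiv_logCore_normalize (M.ν_pos l m) (hp η hη) hs]
  exact h _ (by simpa using norm_smul_inv_norm (𝕜 := ℝ) hs) θ hθ η hη hdist

end ClusteredData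

/-! ### Laplace's method: bounds for a single integral -/

section LaplaceBounds

variable {ι κ : Type*} [Fintype ι] [DecidableEq ι] [Fintype κ] {J : κ → Matrix ι ι ℝ}
  (hJ : ∀ m, (J m).PosDef) {Ω : Set (κ → ι → ℝ)} (hΩ : MeasurableSet Ω)
  {f ρ : (κ → ι → ℝ) → ℝ} (hf : ∀ Θ ∈ Ω, 0 ≤ f Θ) (hρ : ∀ Θ ∈ Ω, 0 ≤ ρ Θ)
  (hfρ : IntegrableOn (fun Θ => f Θ * ρ Θ) Ω)
  {a : κ → ι → ℝ} {d ε : ℝ} (hd : 0 < d) (hε : 0 < ε) (hε' : ε < 1)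
  (hball : Metric.ball a d ⊆ Ω)
  (hfa : ∀ Θ ∈ Metric.ball a d, |f Θ - f a| ≤ ε * f a)

include hJ hΩ hf hρ hfρ hd hε hε' hball hfa

theorem laplace_upper_bound (hfi : IntegrableOn f Ω) (hf1 : ∫ Θ in Ω, f Θ = 1) {τ : ℝ}
    (hτ : 0 ≤ τ)
    (hin : ∀ Θ ∈ Metric.ball a d, ρ Θ ≤ Real.exp (-((1 - ε) / 2) * blockForm J (Θ - a)))
    (hout : ∀ Θ ∈ Ω, Θ ∉ Metric.ball a d → ρ Θ ≤ τ) :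
    ∫ Θ in Ω, f Θ * ρ Θ ≤ (1 + ε) * f a *
      ((1 - ε) ^ (-((Fintype.card κ * Fintype.card ι : ℝ) / 2)) * gaussMass J) + τ := by
  have ha : 0 ≤ f a := hf a (hball (Metric.mem_ball_self hd))
  have hg := integrable_exp_neg_blockForm hJ (t := 1 - ε) (by linarith)
  have hg' := (hg.comp_sub_right a).const_mul ((1 + ε) * f a)
  have hτi := (hfi.integrable_indicator hΩ).const_mul τ
  have hgi : ∫ Θ, (1 + ε) * f a * Real.exp (-((1 - ε) / 2) * blockForm J (Θ - a)) =
      (1 + ε) * f a *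
      ((1 - ε) ^ (-((Fintype.card κ * Fintype.card ι : ℝ) / 2)) * gaussMass J) := by
    rw [integral_const_mul, integral_sub_right_eq_self
      (fun V => Real.exp (-((1 - ε) / 2) * blockForm J V)),
      integral_exp_neg_blockForm hJ (by linarith)]
  have hti : ∫ Θ, τ * Ω.indicator f Θ = τ := by
    rw [integral_const_mul, integral_indicator hΩ, hf1, mul_one]
  rw [← integral_indicator hΩ]
  refine (integral_mono (hfρ.integrable_indicator hΩ) (hg'.add hτi) fun Θ => ?_).trans_eq ?_
  · by_cases hΘ : Θ ∈ Ω
    · simp only [Set.indicator_of_mem hΘ, Pi.add_apply]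
      by_cases hb : Θ ∈ Metric.ball a d
      · have h1 : f Θ ≤ (1 + ε) * f a := by linarith [(abs_le.1 (hfa Θ hb)).2]
        have h2 := mul_le_mul h1 (hin Θ hb) (hρ Θ hΘ) (by positivity)
        have h3 := mul_nonneg hτ (hf Θ hΘ)
        linarith
      · have h1 := mul_le_mul_of_nonneg_left (hout Θ hΘ hb) (hf Θ hΘ)
        have h2 : 0 ≤ (1 + ε) * f a * Real.exp (-((1 - ε) / 2) * blockForm J (Θ - a)) := by
          positivity
        linarith
    · simp only [Set.indicator_of_notMem hΘ, Pi.add_apply, mul_zero, add_zero]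
      positivity
  · rw [← hgi, ← hti, ← integral_add hg' (by simpa [hti] using hτi)]
    simp [hti]

theorem laplace_lower_bound {σ : ℝ} (hσ : 0 ≤ σ)
    (hin : ∀ Θ ∈ Metric.ball a d, Real.exp (-((1 + ε) / 2) * blockForm J (Θ - a)) ≤ ρ Θ)
    (hout : ∀ V, d ≤ ‖V‖ → Real.exp (-(1 / 4) * blockForm J V) ≤ σ) :
    (1 - ε) * f a * (((1 + ε) ^ (-((Fintype.card κ * Fintype.card ι : ℝ) / 2))
      - σ * (1 / 2) ^ (-((Fintype.card κ * Fintype.card ι : ℝ) / 2))) * gaussMass J) ≤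
      ∫ Θ in Ω, f Θ * ρ Θ := by
  have ha : 0 ≤ f a := hf a (hball (Metric.mem_ball_self hd))
  have hg1 := (integrable_exp_neg_blockForm hJ (t := 1 + ε) (by linarith)).comp_sub_right a
  have hg2 := ((integrable_exp_neg_blockForm hJ (t := 1 / 2)
    (by norm_num)).comp_sub_right a).const_mul σ
  have hgi : ∫ Θ, (1 - ε) * f a * (Real.exp (-((1 + ε) / 2) * blockForm J (Θ - a))
      - σ * Real.exp (-(1 / 2 / 2) * blockForm J (Θ - a))) =
      (1 - ε) * f a * (((1 + ε) ^ (-((Fintype.card κ * Fintype.card ι : ℝ) / 2))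
      - σ * (1 / 2) ^ (-((Fintype.card κ * Fintype.card ι : ℝ) / 2))) * gaussMass J) := by
    rw [integral_const_mul, integral_sub hg1 hg2, integral_const_mul, integral_sub_right_eq_self
      (fun V => Real.exp (-((1 + ε) / 2) * blockForm J V)), integral_sub_right_eq_self
      (fun V => Real.exp (-(1 / 2 / 2) * blockForm J V)),
      integral_exp_neg_blockForm hJ (by linarith), integral_exp_neg_blockForm hJ (by norm_num)]
    ring
  rw [← hgi, ← integral_indicator hΩ]
  refine integral_mono ((hg1.sub hg2).const_mul _) (hfρ.integrable_indicator hΩ) fun Θ => ?_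
  have hcoef : 0 ≤ (1 - ε) * f a := mul_nonneg (by linarith) ha
  have hQ := blockForm_nonneg hJ (Θ - a)
  change (1 - ε) * f a * (Real.exp (-((1 + ε) / 2) * blockForm J (Θ - a))
      - σ * Real.exp (-(1 / 2 / 2) * blockForm J (Θ - a))) ≤ _
  by_cases hb : Θ ∈ Metric.ball a d
  · rw [Set.indicator_of_mem (hball hb)]
    have h1 : (1 - ε) * f a ≤ f Θ := by linarith [(abs_le.1 (hfa Θ hb)).1]
    have h2 := mul_le_mul h1 (hin Θ hb) (Real.exp_pos _).le (hf Θ (hball hb))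
    refine le_trans (mul_le_mul_of_nonneg_left (sub_le_self _ ?_) hcoef) h2
    positivity
  · have hnn : 0 ≤ Ω.indicator (fun Θ => f Θ * ρ Θ) Θ :=
      Set.indicator_nonneg (fun Θ hΘ => mul_nonneg (hf Θ hΘ) (hρ Θ hΘ)) Θ
    refine le_trans (mul_nonpos_of_nonneg_of_nonpos hcoef ?_) hnn
    have hV : d ≤ ‖Θ - a‖ := by simpa [dist_eq_norm] using hb
    have h1 : Real.exp (-((1 + ε) / 2) * blockForm J (Θ - a)) ≤
        Real.exp (-(1 / 4) * blockForm J (Θ - a)) * Real.exp (-(1 / 2 / 2) * blockForm J (Θ - a)) := by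
      rw [← Real.exp_add]
      refine Real.exp_le_exp.2 ?_
      nlinarith
    have h2 := mul_le_mul_of_nonneg_right (hout _ hV)
      (Real.exp_pos (-(1 / 2 / 2) * blockForm J (Θ - a))).le
    linarith

end LaplaceBounds

theorem exists_closedBall_subset_compact {E : Type*} [NormedAddCommGroup E] [ProperSpace E]
    {K U : Set E} (hK : IsCompact K) (hU : IsOpen U) (hKU : K ⊆ U) :
    ∃ d > 0, ∃ K', IsCompact K' ∧ K' ⊆ U ∧ ∀ a ∈ K, Metric.closedBall a d ⊆ K' := by
  obtain ⟨d, hd, h⟩ := hK.exists_cthickening_subset_open hU hKU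
  exact ⟨d, hd, _, hK.cthickening, h, fun a ha => Metric.closedBall_subset_cthickening ha d⟩

theorem sq_norm_le_dotProduct_self {ι : Type*} [Fintype ι] (v : ι → ℝ) : ‖v‖ ^ 2 ≤ v ⬝ᵥ v := by
  have h0 : 0 ≤ v ⬝ᵥ v := by simpa using dotProduct_star_self_nonneg v
  have : ‖v‖ ≤ √(v ⬝ᵥ v) := by
    refine (pi_norm_le_iff_of_nonneg (Real.sqrt_nonneg _)).2 fun i => ?_
    refine Real.le_sqrt_of_sq_le ?_
    rw [Real.norm_eq_abs, sq_abs, sq]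
    exact Finset.single_le_sum (f := fun i => v i * v i) (fun j _ => mul_self_nonneg _)
      (Finset.mem_univ i)
  calc _ ≤ √(v ⬝ᵥ v) ^ 2 := by gcongr
    _ = _ := Real.sq_sqrt h0

namespace ClusteredData

variable {r : ℕ} {M : ModelFamily r} {l : M.Idx}

/-! ### The log-likelihood near the estimate -/

theorem exists_logLik_expansion {K : Set (Fin l.1 → Par r)} (hK : IsCompact K)
    (hKΩ : K ⊆ interior (M.Ω l)) {ε : ℝ} (hε : 0 < ε) :
    ∃ d > 0, (∀ a ∈ K, Metric.ball a d ⊆ interior (M.Ω l)) ∧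
      ∀ (N : ℕ) (S : ClusteredData M N), S.IsMLE l → S.est l ∈ K →
        ∀ Θ ∈ Metric.ball (S.est l) d,
          |S.logLik l Θ - S.logLik l (S.est l) + 1 / 2 * blockForm (S.fim l) (Θ - S.est l)| ≤
            ε * ∑ m, S.size l m * ‖Θ m - S.est l m‖ ^ 2 := by
  obtain ⟨d₀, hd₀, K', hK', hK'Ω, hball⟩ :=
    exists_closedBall_subset_compact hK isOpen_interior hKΩ
  have hproj (m : Fin l.1) : IsCompact ((fun Θ : Fin l.1 → Par r => Θ m) '' K') :=
    hK'.image (continuous_apply m)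
  have hpd (m : Fin l.1) : ∀ θ ∈ (fun Θ : Fin l.1 → Par r => Θ m) '' K',
      ∀ᶠ η in 𝓝 θ, (scat η).PosDef := by
    rintro _ ⟨Θ, hΘ, rfl⟩
    exact M.eventually_posDef (hK'Ω hΘ) m
  choose d₁ hd₁ hD using fun m : Fin l.1 =>
    exists_norm_fderiv_fderiv_clusterLogLik_sub_le m (hproj m) (hpd m) hε
  obtain ⟨d, hd, hdd⟩ : ∃ d > 0, d ≤ d₀ ∧ ∀ m, d ≤ d₁ m := by
    have : ∀ᶠ d in 𝓝[>] (0 : ℝ), d ≤ d₀ ∧ ∀ m, d ≤ d₁ m := by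
      refine nhdsWithin_le_nhds ((eventually_le_nhds hd₀).and (eventually_all.2 fun m =>
        eventually_le_nhds (hd₁ m)))
    obtain ⟨d, hd, hd'⟩ := (this.and self_mem_nhdsWithin).exists
    exact ⟨d, hd', hd⟩
  have hsub (a) (ha : a ∈ K) : Metric.ball a d ⊆ interior (M.Ω l) := fun Θ hΘ =>
    hK'Ω (hball a ha ((Metric.ball_subset_closedBall.trans
      (Metric.closedBall_subset_closedBall hdd.1)) hΘ))
  refine ⟨d, hd, hsub, fun N S hS ha Θ hΘ => ?_⟩
  have hmem (m : Fin l.1) (θ : Par r) (hθ : θ ∈ Metric.ball (S.est l m) d) :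
      θ ∈ (fun Θ : Fin l.1 → Par r => Θ m) '' K' := by
    refine ⟨Function.update (S.est l) m θ, hball _ ha ?_, by simp⟩
    rw [Metric.mem_closedBall, dist_pi_le_iff hd₀.le]
    intro k
    rcases eq_or_ne k m with rfl | hk
    · simpa using (Metric.mem_ball.1 hθ).le.trans hdd.1
    · simpa [hk] using hd₀.le
  have hΘm (m : Fin l.1) : Θ m ∈ Metric.ball (S.est l m) d :=
    (dist_le_pi_dist Θ (S.est l) m).trans_lt hΘ
  have hcl (m : Fin l.1) : |S.clusterLogLik l m (Θ m) - S.clusterLogLik l m (S.est l m)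
      + 1 / 2 * ((Θ - S.est l) m ⬝ᵥ S.fim l m *ᵥ (Θ - S.est l) m)| ≤
      S.size l m * ε * ‖Θ m - S.est l m‖ ^ 2 := by
    have := abs_sub_taylorTwo_le (f := S.clusterLogLik l m) (a := S.est l m) (d := d)
      (ε := S.size l m * ε) (by positivity)
      (fun θ hθ => S.contDiffAt_clusterLogLik (k := 2) l (hpd m θ (hmem m θ hθ)))
      (fun θ hθ => hD m N S _ (hmem m _ (Metric.mem_ball_self hd)) θ (hmem m θ hθ)
        ((Metric.mem_ball.1 hθ).trans_le (hdd.2 m))) (hΘm m)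
    rw [taylorTwo, S.fderiv_clusterLogLik_est hS, S.fderiv_fderiv_clusterLogLik_apply] at this
    convert! this using 2
    simp only [zero_apply, Pi.sub_apply]
    ring
  have hpos := M.Ω_posDef l Θ (interior_subset (hsub _ ha hΘ))
  have hpos' := M.Ω_posDef l _ (interior_subset hS.1)
  rw [S.logLik_eq_sum l hpos, S.logLik_eq_sum l hpos', blockForm, Finset.mul_sum, Finset.mul_sum,
    ← Finset.sum_sub_distrib, ← Finset.sum_add_distrib]
  refine (Finset.abs_sum_le_sum_abs _ _).trans (Finset.sum_le_sum fun m _ => ?_)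
  exact (hcl m).trans_eq (by ring)

end ClusteredData

namespace ClusteredData

variable {r : ℕ} {M : ModelFamily r}

/-! ### The integrated likelihood -/

section Evidence

variable {N : ℕ} (S : ClusteredData M N) (l : M.Idx)

theorem lik_eq_exp_logLik {Θ : Fin l.1 → Par r} (hΘ : Θ ∈ M.Ω l) :
    S.lik l Θ = Real.exp (S.logLik l Θ) :=
  (Real.exp_log (S.lik_pos l (M.Ω_posDef l Θ hΘ))).symm

theorem continuousOn_lik : ContinuousOn (S.lik l) (M.Ω l) := by
  have h : ∀ Θ ∈ M.Ω l, S.lik l Θ = Real.exp (∑ m, (S.size l m *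
      (Real.log ((S.size l m : ℝ) / N) + (Real.log (tNorm r (M.ν l m))
        + (M.ν l m + r) / 2 * Real.log (M.ν l m)))
      + ∑ n ∈ S.cluster l m, logCore (M.ν l m) (1, S.x n) (Θ m))) := fun Θ hΘ => by
    rw [S.lik_eq_exp_logLik l hΘ, S.logLik_eq_sum l (M.Ω_posDef l Θ hΘ)]
    exact congrArg _ (Finset.sum_congr rfl fun m _ =>
      S.log_clusterLik_eq_logCore l (M.Ω_posDef l Θ hΘ m))
  refine ContinuousOn.congr (fun Θ hΘ => ContinuousAt.continuousWithinAt ?_) h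
  refine Real.continuous_exp.continuousAt.comp (tendsto_finsetSum _ fun m _ =>
    tendsto_const_nhds.add (tendsto_finsetSum _ fun n _ => ?_))
  exact ((contDiffAt_logCore (k := 0) (M.ν_pos l m) (by simp)
    (M.Ω_posDef l Θ hΘ m)).continuousAt).tendsto.comp (continuous_apply m).continuousAt

theorem evidence_nonneg : 0 ≤ S.evidence l :=
  setIntegral_nonneg (M.Ω_meas l) fun Θ hΘ =>
    mul_nonneg (M.f_nonneg l Θ hΘ) (S.lik_pos l (M.Ω_posDef l Θ hΘ)).le

theorem marginal_pos (h : 0 < S.evidence l) : 0 < S.marginal :=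
  Finset.sum_pos' (fun k _ => mul_nonneg (M.p_pos k).le (S.evidence_nonneg k))
    ⟨l, Finset.mem_univ l, mul_pos (M.p_pos l) h⟩

variable {l}

theorem lik_le_lik_est (h : S.IsMLE l) {Θ : Fin l.1 → Par r} (hΘ : Θ ∈ M.Ω l) :
    S.lik l Θ ≤ S.lik l (S.est l) := by
  rw [S.lik_eq_exp_logLik l hΘ, S.lik_eq_exp_logLik l (interior_subset h.1)]
  exact Real.exp_le_exp.2 (h.2 hΘ)

theorem integrableOn_prior_mul_lik (h : S.IsMLE l) :
    IntegrableOn (fun Θ => M.f l Θ * S.lik l Θ) (M.Ω l) := by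
  refine Integrable.mul_bdd (c := S.lik l (S.est l)) (M.f_int l)
    ((S.continuousOn_lik l).aestronglyMeasurable (M.Ω_meas l)) ?_
  refine (ae_restrict_iff' (M.Ω_meas l)).2 (ae_of_all _ fun Θ hΘ => ?_)
  rw [Real.norm_of_nonneg (S.lik_pos l (M.Ω_posDef l Θ hΘ)).le]
  exact S.lik_le_lik_est h hΘ

/-- The ratio of the integrated likelihood to its Laplace approximation. -/
def evidenceRatio (l : M.Idx) : ℝ :=
  S.evidence l / (M.f l (S.est l) * S.lik l (S.est l) * gaussMass (S.fim l))

theorem integral_prior_mul_likRatio (l : M.Idx) :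
    ∫ Θ in M.Ω l, M.f l Θ * (S.lik l Θ / S.lik l (S.est l)) =
      S.evidence l / S.lik l (S.est l) := by
  simp_rw [← mul_div_assoc]
  rw [integral_div, evidence]

theorem fim_quadratic_lower {e : ℝ} {m : Fin l.1} (hs : 0 < S.size l m)
    (he : (((S.size l m : ℝ)⁻¹ • S.fim l m) - (e : ℝ) • 1).PosSemidef) (v : Par r) :
    S.size l m * e * (v ⬝ᵥ v) ≤ v ⬝ᵥ S.fim l m *ᵥ v := by
  have := he.dotProduct_mulVec_nonneg v
  simp only [star_trivial, Matrix.sub_mulVec, Matrix.smul_mulVec, Matrix.one_mulVec,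
    dotProduct_sub, dotProduct_smul, smul_eq_mul] at this
  have hs' : (0 : ℝ) < S.size l m := by exact_mod_cast hs
  have := mul_nonneg hs'.le this
  rw [mul_sub, mul_inv_cancel_left₀ hs'.ne'] at this
  linarith

theorem fim_posDef {e : ℝ} (he0 : 0 < e) {m : Fin l.1} (hs : 0 < S.size l m)
    (he : (((S.size l m : ℝ)⁻¹ • S.fim l m) - (e : ℝ) • 1).PosSemidef) :
    (S.fim l m).PosDef := by
  have hs' : (0 : ℝ) < S.size l m := by exact_mod_cast hs
  have h1 : ((S.size l m : ℝ)⁻¹ • S.fim l m).PosDef := by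
    have := Matrix.PosDef.posSemidef_add he (Matrix.PosDef.one.smul he0)
    simpa using this
  simpa [smul_smul, hs'.ne'] using h1.smul hs'

theorem blockForm_fim_lower {e : ℝ} (he0 : 0 < e) (hs : ∀ m, 0 < S.size l m)
    (he : ∀ m, (((S.size l m : ℝ)⁻¹ • S.fim l m) - (e : ℝ) • 1).PosSemidef)
    (V : Fin l.1 → Par r) :
    e * ∑ m, S.size l m * ‖V m‖ ^ 2 ≤ blockForm (S.fim l) V := by
  rw [Finset.mul_sum]
  refine Finset.sum_le_sum fun m _ => le_trans ?_ (S.fim_quadratic_lower (hs m) (he m) (V m))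
  calc _ = S.size l m * e * ‖V m‖ ^ 2 := by ring
    _ ≤ _ := by gcongr; exact sq_norm_le_dotProduct_self _

end Evidence

end ClusteredData

/-! ### Asymptotics -/

section Asymptotic

open ClusteredData

variable {r : ℕ} {M : ModelFamily r} {S : ∀ N : ℕ, ClusteredData M N} (H : RegularSeq M S)
  {l : M.Idx}
include H

theorem RegularSeq.tendsto_size (m : Fin l.1) :
    Tendsto (fun N => ((S N).size l m : ℝ)) atTop atTop := by
  have h1 := (H.growth l m).bound one_pos
  have h2 : Tendsto (fun N : ℕ => Real.log N) atTop atTop :=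
    Real.tendsto_log_atTop.comp tendsto_natCast_atTop_atTop
  refine tendsto_atTop_mono' _ ?_ h2
  filter_upwards [h1] with N hN
  simpa using (le_abs_self _).trans hN

theorem RegularSeq.tendsto_exp_neg_size {c : ℝ} (hc : 0 < c) (m : Fin l.1) :
    Tendsto (fun N => Real.exp (-c * (S N).size l m)) atTop (𝓝 0) :=
  Real.tendsto_exp_atBot.comp ((H.tendsto_size m).const_mul_atTop_of_neg (neg_neg_of_pos hc))

theorem RegularSeq.tendsto_pow_mul_exp_neg_size {c : ℝ} (hc : 0 < c) (p : ℕ) (m : Fin l.1) :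
    Tendsto (fun N : ℕ => (N : ℝ) ^ p * Real.exp (-c * (S N).size l m)) atTop (𝓝 0) := by
  have h1 := (H.growth l m).bound (show 0 < c / 2 / (p + 1) by positivity)
  refine squeeze_zero' (Eventually.of_forall fun N => by positivity) ?_
    (H.tendsto_exp_neg_size (half_pos hc) m)
  filter_upwards [h1, eventually_ge_atTop 1] with N hN hN1
  have hpos : (0 : ℝ) < N := by exact_mod_cast hN1
  have h2 : Real.log N * (p + 1) ≤ c / 2 * (S N).size l m := by
    have h3 := (le_abs_self _).trans hN
    rw [Real.norm_natCast, div_mul_eq_mul_div, le_div_iff₀ (by positivity)] at h3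
    exact h3
  have h4 : 0 ≤ Real.log N := Real.log_natCast_nonneg N
  have h5 : (N : ℝ) ^ p = Real.exp (p * Real.log N) := by
    rw [Real.exp_nat_mul, Real.exp_log hpos]
  rw [h5, ← Real.exp_add]
  exact Real.exp_le_exp.2 (by linarith)

theorem RegularSeq.eventually_size_pos :
    ∀ᶠ N in atTop, ∀ m, 0 < (S N).size l m := by
  filter_upwards [H.nonempty l] with N hN m using (S N).size_pos_of_surjective l hN m

theorem RegularSeq.eventually_fim_posDef :
    ∀ᶠ N in atTop, ∀ m, ((S N).fim l m).PosDef := by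
  obtain ⟨e, he, hE⟩ := H.eigenvalues l
  filter_upwards [hE, H.eventually_size_pos (l := l)] with N hN hs m
  exact (S N).fim_posDef he (hs m) (hN m)

theorem RegularSeq.exists_inv_gaussMass_le :
    ∃ B : ℝ, ∃ p : ℕ, 0 ≤ B ∧ ∀ᶠ N : ℕ in atTop, (gaussMass ((S N).fim l))⁻¹ ≤ B * (N : ℝ) ^ p := by
  obtain ⟨K, hK, hKΩ, -, hKev⟩ := H.compact l
  have hproj (m : Fin l.1) : IsCompact ((fun Θ : Fin l.1 → Par r => Θ m) '' K) :=
    hK.image (continuous_apply m)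
  have hpd (m : Fin l.1) : ∀ θ ∈ (fun Θ : Fin l.1 → Par r => Θ m) '' K,
      ∀ᶠ η in 𝓝 θ, (scat η).PosDef := by
    rintro _ ⟨Θ, hΘ, rfl⟩
    exact M.eventually_posDef (hKΩ hΘ) m
  choose C hC using fun m : Fin l.1 =>
    exists_norm_fderiv_fderiv_clusterLogLik_le m (hproj m) (hpd m)
  set q := Fintype.card (ParIdx r) with hq
  refine ⟨∏ m, (1 + q.factorial * |C m| ^ q), q * Fintype.card (Fin l.1), by positivity, ?_⟩
  filter_upwards [hKev, H.eventually_fim_posDef (l := l), eventually_ge_atTop 1] with N hN hJ hN1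
  have hN1' : (1 : ℝ) ≤ N := by exact_mod_cast hN1
  rw [gaussMass, ← Finset.prod_inv_distrib, pow_mul, ← Finset.card_univ (α := Fin l.1),
    ← Finset.prod_const, ← Finset.prod_mul_distrib]
  refine Finset.prod_le_prod (fun m _ => by positivity) fun m _ => ?_
  have hdet := (hJ m).det_pos
  have h2π : (1 : ℝ) ≤ (2 * Real.pi) ^ ((Fintype.card (ParIdx r) : ℝ) / 2) :=
    Real.one_le_rpow (by linarith [Real.pi_gt_three]) (by positivity)
  have hentry (i j : ParIdx r) : |(S N).fim l m i j| ≤ N * |C m| := by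
    have h1 := hC m N (S N) _ ⟨_, hN, rfl⟩
    have h2 : (S N).fim l m i j = -(fderiv ℝ (fderiv ℝ ((S N).clusterLogLik l m))
      ((S N).est l m) (Pi.single i 1) (Pi.single j 1)) := rfl
    rw [h2, abs_neg, ← Real.norm_eq_abs]
    refine (ContinuousLinearMap.le_opNorm₂ _ _ _).trans ?_
    have hs : ((S N).size l m : ℝ) ≤ N := by exact_mod_cast (S N).size_le l m
    simp only [Pi.norm_single, norm_one, mul_one]
    calc _ ≤ (S N).size l m * C m := h1
      _ ≤ (S N).size l m * |C m| := by gcongr; exact le_abs_self _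
      _ ≤ _ := by gcongr
  have hdet' : ((S N).fim l m).det ≤ q.factorial * |C m| ^ q * (N : ℝ) ^ q := by
    have := Matrix.det_le (abv := AbsoluteValue.abs) (A := (S N).fim l m) hentry
    refine (le_abs_self _).trans (this.trans_eq ?_)
    rw [nsmul_eq_mul, mul_pow]
    ring
  have hpow : (1 : ℝ) ≤ (N : ℝ) ^ q := one_le_pow₀ hN1'
  have hsqrt : √((S N).fim l m).det ≤ 1 + ((S N).fim l m).det := by
    rw [Real.sqrt_le_left (by positivity)]
    nlinarith
  rw [inv_div]
  calc √((S N).fim l m).det / _ ≤ √((S N).fim l m).det := div_le_self (Real.sqrt_nonneg _) h2π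
    _ ≤ 1 + ((S N).fim l m).det := hsqrt
    _ ≤ 1 * (N : ℝ) ^ q + q.factorial * |C m| ^ q * (N : ℝ) ^ q := by linarith
    _ = _ := by ring

end Asymptotic

section CompactPositive

variable {E : Type*} [NormedAddCommGroup E] {K U : Set E} (hK : IsCompact K)
  (hU : IsOpen U) (hKU : K ⊆ U) {f : E → ℝ} (hf : ContinuousOn f U) (hpos : ∀ x ∈ K, 0 < f x)
include hK hKU hf hpos

theorem exists_pos_lower_upper_bound : ∃ c > 0, ∃ C, ∀ x ∈ K, c ≤ f x ∧ f x ≤ C := by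
  rcases K.eq_empty_or_nonempty with rfl | hne
  · exact ⟨1, one_pos, 0, by simp⟩
  · obtain ⟨a, ha, hmin⟩ := hK.exists_isMinOn hne (hf.mono hKU)
    obtain ⟨b, hb, hmax⟩ := hK.exists_isMaxOn hne (hf.mono hKU)
    exact ⟨f a, hpos a ha, f b, fun x hx => ⟨hmin hx, hmax hx⟩⟩

include hU in
theorem exists_uniform_relative_continuity [ProperSpace E] {ε : ℝ} (hε : 0 < ε) :
    ∃ d > 0, ∀ a ∈ K, ∀ x ∈ Metric.ball a d, |f x - f a| ≤ ε * f a := by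
  obtain ⟨c, hc, _, hcf⟩ := exists_pos_lower_upper_bound hK hKU hf hpos
  obtain ⟨d₀, hd₀, K', hK', hK'U, hball⟩ := exists_closedBall_subset_compact hK hU hKU
  obtain ⟨d, hd, h⟩ := Metric.uniformContinuousOn_iff.1
    (hK'.uniformContinuousOn_of_continuous (hf.mono hK'U)) (ε * c) (by positivity)
  refine ⟨min d d₀, lt_min hd hd₀, fun a ha x hx => ?_⟩
  have hx' := lt_min_iff.1 (Metric.mem_ball.1 hx)
  have h1 := h x (hball a ha hx'.2.le) a (hball a ha (Metric.mem_closedBall_self hd₀.le)) hx'.1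
  rw [Real.dist_eq] at h1
  exact h1.le.trans (mul_le_mul_of_nonneg_left (hcf a ha).1 hε.le)

end CompactPositive

section Asymptotic

open ClusteredData

variable {r : ℕ} {M : ModelFamily r} {S : ∀ N : ℕ, ClusteredData M N} (H : RegularSeq M S)
  {l : M.Idx}
include H

theorem RegularSeq.exists_evidenceRatio_bounds {ε : ℝ} (hε : 0 < ε) (hε' : ε < 1) :
    ∃ s t : ℕ → ℝ, Tendsto s atTop (𝓝 0) ∧ Tendsto t atTop (𝓝 0) ∧ ∀ᶠ N in atTop,
      (1 - ε) * ((1 + ε) ^ (-((Fintype.card (Fin l.1) * Fintype.card (ParIdx r) : ℝ) / 2)) - s N)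
        ≤ (S N).evidenceRatio l ∧
      (S N).evidenceRatio l ≤ (1 + ε) *
        (1 - ε) ^ (-((Fintype.card (Fin l.1) * Fintype.card (ParIdx r) : ℝ) / 2)) + t N := by
  obtain ⟨K, hK, hKΩ, hKf, hKev⟩ := H.compact l
  obtain ⟨e, he, hE⟩ := H.eigenvalues l
  obtain ⟨B, p, hB, hG⟩ := H.exists_inv_gaussMass_le (l := l)
  obtain ⟨c, hc, _, hcf⟩ := exists_pos_lower_upper_bound hK hKΩ (M.f_cont l) hKf
  obtain ⟨d₁, hd₁, hball, hexp⟩ := exists_logLik_expansion hK hKΩ (ε := ε / 2 * e) (by positivity)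
  obtain ⟨d₂, hd₂, hfa⟩ := exists_uniform_relative_continuity hK isOpen_interior hKΩ (M.f_cont l)
    hKf hε
  set d := min d₁ d₂ with hd
  have hdpos : 0 < d := lt_min hd₁ hd₂
  obtain ⟨κ, hκ, hsep⟩ := H.separated l d hdpos
  set n : ℝ := (Fintype.card (Fin l.1) * Fintype.card (ParIdx r) : ℝ) / 2 with hn
  set σ : ℕ → ℝ := fun N => ∑ m, Real.exp (-(e * d ^ 2 / 4) * (S N).size l m) with hσ
  set τ : ℕ → ℝ := fun N => ∑ m, Real.exp (-κ * (S N).size l m) with hτ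
  have hσ0 : Tendsto σ atTop (𝓝 0) := by
    have := tendsto_finsetSum (Finset.univ : Finset (Fin l.1)) fun m _ =>
      H.tendsto_exp_neg_size (l := l) (show 0 < e * d ^ 2 / 4 by positivity) m
    simpa [hσ] using this
  have hτ0 : Tendsto (fun N : ℕ => (N : ℝ) ^ p * τ N) atTop (𝓝 0) := by
    have := tendsto_finsetSum (Finset.univ : Finset (Fin l.1)) fun m _ =>
      H.tendsto_pow_mul_exp_neg_size (l := l) hκ p m
    simpa [hτ, Finset.mul_sum] using this
  refine ⟨fun N => σ N * (1 / 2) ^ (-n), fun N => B / c * ((N : ℝ) ^ p * τ N),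
    by simpa using hσ0.mul_const ((1 / 2 : ℝ) ^ (-n)), by simpa using hτ0.const_mul (B / c), ?_⟩
  filter_upwards [hKev, hE, hG, hsep, H.isMLE l, H.eventually_size_pos (l := l),
    H.eventually_fim_posDef (l := l)] with N ha hN hGN hsepN hmle hsize hJ
  set a := (S N).est l with haa
  have haΩ : a ∈ M.Ω l := interior_subset hmle.1
  have hL : 0 < (S N).lik l a := (S N).lik_pos l (M.Ω_posDef l _ haΩ)
  have hfpos := hKf a ha
  have hGpos := gaussMass_pos hJ
  have hsub : Metric.ball a d ⊆ M.Ω l :=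
    ((Metric.ball_subset_ball (min_le_left _ _)).trans (hball a ha)).trans interior_subset
  set ρ : (Fin l.1 → Par r) → ℝ := fun Θ => (S N).lik l Θ / (S N).lik l a with hρdef
  have hρexp (Θ) (hΘ : Θ ∈ M.Ω l) : ρ Θ = Real.exp ((S N).logLik l Θ - (S N).logLik l a) := by
    rw [Real.exp_sub, ← (S N).lik_eq_exp_logLik l hΘ, ← (S N).lik_eq_exp_logLik l haΩ]
  have hρ0 : ∀ Θ ∈ M.Ω l, 0 ≤ ρ Θ := fun Θ hΘ => by rw [hρexp Θ hΘ]; positivity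
  have hfρ : IntegrableOn (fun Θ => M.f l Θ * ρ Θ) (M.Ω l) := by
    simp_rw [hρdef, ← mul_div_assoc]
    exact ((S N).integrableOn_prior_mul_lik hmle).div_const _
  have hfball : ∀ Θ ∈ Metric.ball a d, |M.f l Θ - M.f l a| ≤ ε * M.f l a := fun Θ hΘ =>
    hfa a ha Θ (Metric.ball_subset_ball (min_le_right _ _) hΘ)
  have hquad (V : Fin l.1 → Par r) := (S N).blockForm_fim_lower he hsize hN V
  have hexp' (Θ) (hΘ : Θ ∈ Metric.ball a d) :
      |(S N).logLik l Θ - (S N).logLik l a + 1 / 2 * blockForm ((S N).fim l) (Θ - a)| ≤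
        ε / 2 * blockForm ((S N).fim l) (Θ - a) := by
    refine (hexp N (S N) hmle ha Θ (Metric.ball_subset_ball (min_le_left _ _) hΘ)).trans ?_
    rw [mul_assoc]
    exact mul_le_mul_of_nonneg_left (hquad (Θ - a)) (by positivity)
  have hup := laplace_upper_bound hJ (M.Ω_meas l) (M.f_nonneg l) hρ0 hfρ hdpos hε hε' hsub hfball
    (M.f_int l) (M.f_one l) (τ := τ N) (by positivity)
    (fun Θ hΘ => by
      rw [hρexp Θ (hsub hΘ)]
      refine Real.exp_le_exp.2 ?_
      linarith [(abs_le.1 (hexp' Θ hΘ)).2])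
    (fun Θ hΘ hb => by
      have hnorm : d ≤ ‖Θ - a‖ := by simpa [dist_eq_norm] using hb
      obtain ⟨m, hm⟩ : ∃ m, d ≤ ‖Θ m - a m‖ := by
        by_contra! hcon
        exact absurd hnorm (not_le.2 ((pi_norm_lt_iff hdpos).2 hcon))
      rw [hρexp Θ hΘ]
      refine le_trans (Real.exp_le_exp.2 ?_) (Finset.single_le_sum
        (f := fun m => Real.exp (-κ * (S N).size l m)) (fun k _ => (Real.exp_pos _).le)
        (Finset.mem_univ m))
      linarith [hsepN Θ hΘ m hm])
  have hlow := laplace_lower_bound hJ (M.Ω_meas l) (M.f_nonneg l) hρ0 hfρ hdpos hε hε' hsub hfball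
    (σ := σ N) (by positivity)
    (fun Θ hΘ => by
      rw [hρexp Θ (hsub hΘ)]
      refine Real.exp_le_exp.2 ?_
      linarith [(abs_le.1 (hexp' Θ hΘ)).1])
    (fun V hV => by
      obtain ⟨m, hm⟩ : ∃ m, d ≤ ‖V m‖ := by
        by_contra! hcon
        exact absurd hV (not_le.2 ((pi_norm_lt_iff hdpos).2 hcon))
      refine le_trans (Real.exp_le_exp.2 ?_) (Finset.single_le_sum
        (f := fun m => Real.exp (-(e * d ^ 2 / 4) * (S N).size l m))
        (fun k _ => (Real.exp_pos _).le) (Finset.mem_univ m))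
      have h1 := hquad V
      have h2 : (S N).size l m * d ^ 2 ≤ ∑ m, (S N).size l m * ‖V m‖ ^ 2 :=
        le_trans (by gcongr) (Finset.single_le_sum
          (f := fun m => ((S N).size l m : ℝ) * ‖V m‖ ^ 2) (fun k _ => by positivity)
          (Finset.mem_univ m))
      have h3 := mul_le_mul_of_nonneg_left h2 he.le
      linarith)
  rw [(S N).integral_prior_mul_likRatio l] at hup hlow
  have hR : (S N).evidence l / (S N).lik l a =
      (S N).evidenceRatio l * (M.f l a * gaussMass ((S N).fim l)) := by
    rw [evidenceRatio, ← haa]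
    field_simp
  have hden : 0 < M.f l a * gaussMass ((S N).fim l) := by positivity
  rw [hR] at hup hlow
  constructor
  · refine le_of_mul_le_mul_right (le_trans (le_of_eq ?_) hlow) hden
    ring
  · have h1 : τ N ≤ B / c * ((N : ℝ) ^ p * τ N) * (M.f l a * gaussMass ((S N).fim l)) := by
      have h2 : 1 ≤ B / c * (N : ℝ) ^ p * (M.f l a * gaussMass ((S N).fim l)) := by
        have h3 : 1 ≤ B * (N : ℝ) ^ p * gaussMass ((S N).fim l) := by
          rwa [inv_le_iff_one_le_mul₀ hGpos] at hGN
        have h4 : 1 ≤ M.f l a / c := (one_le_div hc).2 (hcf a ha).1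
        calc (1 : ℝ) = 1 * 1 := by ring
          _ ≤ (B * (N : ℝ) ^ p * gaussMass ((S N).fim l)) * (M.f l a / c) := by gcongr
          _ = _ := by ring
      have h5 : 0 ≤ τ N := by positivity
      calc τ N = 1 * τ N := by ring
        _ ≤ _ := mul_le_mul_of_nonneg_right h2 h5
        _ = _ := by ring
    refine le_of_mul_le_mul_right (hup.trans ?_) hden
    calc _ ≤ _ := add_le_add_right h1 _
      _ = _ := by ring

theorem RegularSeq.tendsto_evidenceRatio :
    Tendsto (fun N => (S N).evidenceRatio l) atTop (𝓝 1) := by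
  set n : ℝ := (Fintype.card (Fin l.1) * Fintype.card (ParIdx r) : ℝ) / 2 with hn
  have hlo : Tendsto (fun ε : ℝ => (1 - ε) * (1 + ε) ^ (-n)) (𝓝[>] 0) (𝓝 1) := by
    have : ContinuousAt (fun ε : ℝ => (1 - ε) * (1 + ε) ^ (-n)) 0 :=
      (continuousAt_const.sub continuousAt_id).mul
        ((continuousAt_const.add continuousAt_id).rpow_const (Or.inl (by simp)))
    simpa using this.tendsto.mono_left nhdsWithin_le_nhds
  have hhi : Tendsto (fun ε : ℝ => (1 + ε) * (1 - ε) ^ (-n)) (𝓝[>] 0) (𝓝 1) := by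
    have : ContinuousAt (fun ε : ℝ => (1 + ε) * (1 - ε) ^ (-n)) 0 :=
      (continuousAt_const.add continuousAt_id).mul
        ((continuousAt_const.sub continuousAt_id).rpow_const (Or.inl (by simp)))
    simpa using this.tendsto.mono_left nhdsWithin_le_nhds
  refine tendsto_order.2 ⟨fun b hb => ?_, fun b hb => ?_⟩
  · obtain ⟨ε, ⟨h1, h2⟩, h3⟩ := (((hlo.eventually (lt_mem_nhds hb)).and
      (nhdsWithin_le_nhds (eventually_lt_nhds one_pos))).and self_mem_nhdsWithin).exists
    obtain ⟨s, t, hs, -, hst⟩ := H.exists_evidenceRatio_bounds (l := l) h3 h2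
    have h4 : Tendsto (fun N => (1 - ε) * ((1 + ε) ^ (-n) - s N)) atTop
        (𝓝 ((1 - ε) * (1 + ε) ^ (-n))) := by
      simpa using (hs.const_sub ((1 + ε) ^ (-n))).const_mul (1 - ε)
    filter_upwards [hst, h4.eventually (lt_mem_nhds h1)] with N hN hN'
    exact hN'.trans_le hN.1
  · obtain ⟨ε, ⟨h1, h2⟩, h3⟩ := (((hhi.eventually (gt_mem_nhds hb)).and
      (nhdsWithin_le_nhds (eventually_lt_nhds one_pos))).and self_mem_nhdsWithin).exists
    obtain ⟨s, t, -, ht, hst⟩ := H.exists_evidenceRatio_bounds (l := l) h3 h2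
    have h4 : Tendsto (fun N => (1 + ε) * (1 - ε) ^ (-n) + t N) atTop
        (𝓝 ((1 + ε) * (1 - ε) ^ (-n))) := by
      simpa using ht.const_add ((1 + ε) * (1 - ε) ^ (-n))
    filter_upwards [hst, h4.eventually (gt_mem_nhds h1)] with N hN hN'
    exact hN.2.trans_lt hN'

theorem RegularSeq.eventually_posterior_eq : ∀ᶠ N in atTop, 0 < (S N).posterior l ∧
    Real.log ((S N).posterior l) - (S N).logPosteriorExpansion l =
      Real.log ((S N).evidenceRatio l) := by
  obtain ⟨K, -, -, hKf, hKev⟩ := H.compact l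
  filter_upwards [hKev, H.isMLE l, H.eventually_fim_posDef (l := l),
    H.tendsto_evidenceRatio.eventually (lt_mem_nhds one_pos)] with N ha hmle hJ hR
  have haΩ : (S N).est l ∈ M.Ω l := interior_subset hmle.1
  have hL := (S N).lik_pos l (M.Ω_posDef l _ haΩ)
  have hf := hKf _ ha
  have hG := gaussMass_pos hJ
  have hden : 0 < M.f l ((S N).est l) * (S N).lik l ((S N).est l) * gaussMass ((S N).fim l) := by
    positivity
  have hev : 0 < (S N).evidence l := (div_pos_iff_of_pos_right hden).1 hR
  have hm := (S N).marginal_pos l hev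
  have hp := M.p_pos l
  refine ⟨by rw [posterior]; positivity, ?_⟩
  rw [posterior, evidenceRatio, Real.log_div (by positivity) hm.ne',
    Real.log_mul hp.ne' hev.ne', Real.log_div hev.ne' hden.ne',
    Real.log_mul (by positivity) hG.ne', Real.log_mul hf.ne' hL.ne', log_gaussMass hJ,
    card_parIdx, Fintype.card_fin, logPosteriorExpansion]
  simp only [logLik]
  ring

theorem RegularSeq.tendsto_log_posterior_sub : Tendsto
    (fun N => Real.log ((S N).posterior l) - (S N).logPosteriorExpansion l) atTop (𝓝 0) := by
  have h := (H.tendsto_evidenceRatio (l := l)).log one_ne_zero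
  rw [Real.log_one] at h
  exact h.congr' (H.eventually_posterior_eq.mono fun N hN => hN.2.symm)

theorem RegularSeq.log_posterior_sub_bicF_isBigO :
    (fun N => Real.log ((S N).posterior l) - ((S N).bicF l - Real.log (S N).marginal))
      =O[atTop] (fun _ => (1 : ℝ)) := by
  obtain ⟨K, hK, hKΩ, hKf, hKev⟩ := H.compact l
  obtain ⟨c, hc, C, hcf⟩ := exists_pos_lower_upper_bound hK hKΩ (M.f_cont l) hKf
  have h1 := (H.tendsto_log_posterior_sub (l := l)).isBigO_one ℝ
  have h2 : (fun N => Real.log (M.f l ((S N).est l))) =O[atTop] (fun _ => (1 : ℝ)) := by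
    refine IsBigO.of_bound (max |Real.log c| |Real.log C|) ?_
    filter_upwards [hKev] with N hN
    have hb := hcf _ hN
    rw [norm_one, mul_one, Real.norm_eq_abs]
    exact abs_le_max_abs_abs (Real.log_le_log hc hb.1) (Real.log_le_log (hKf _ hN) hb.2)
  have h3 : (fun _ : ℕ => Real.log (M.p l) + (l.1 : ℝ) * numPar r / 2 * Real.log (2 * Real.pi))
      =O[atTop] (fun _ => (1 : ℝ)) := isBigO_const_const _ one_ne_zero _
  refine ((h1.add h2).add h3).congr_left fun N => ?_
  rw [logPosteriorExpansion, bicF]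
  ring

end Asymptotic

end

theorem corollary1 {r : ℕ} (hr : 0 < r) (M : ModelFamily r) :
    -- finite sample size: one data set
    (∀ (N : ℕ) (S : ClusteredData M N) (l : M.Idx),
      Function.Surjective (S.label l) → S.IsMLE l →
        (∀ m, S.fim l m =
            Matrix.fromBlocks (-S.Jmm l m) (-S.JmP l m) (-(S.JmP l m)ᵀ) (-S.JPP l m)) ∧
        (∀ m, IsUnit (S.JPP l m).det ∧ (S.fim l m).det = S.schurDet l m) ∧
        S.logLik l (S.est l) = S.fidelity l - N * Real.log N ∧
        S.bicF l =
          S.fidelity l - 1 / 2 * ∑ m, Real.log (S.schurDet l m) - N * Real.log N ∧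
        ((∀ m, (S.fim l m).PosDef) → 0 < M.f l (S.est l) → 0 < S.marginal →
          0 < S.laplacePosterior l ∧
          Real.log (S.laplacePosterior l) = S.logPosteriorExpansion l)) ∧
    -- accuracy of the approximation for growing data size
    (∀ S : ∀ N : ℕ, ClusteredData M N, RegularSeq M S → ∀ l : M.Idx,
      (∀ᶠ N in atTop, 0 < (S N).posterior l) ∧
      Tendsto (fun N => Real.log ((S N).posterior l) - (S N).logPosteriorExpansion l)
        atTop (𝓝 0) ∧
      (fun N => Real.log ((S N).posterior l) - ((S N).bicF l - Real.log (S N).marginal))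
        =O[atTop] (fun _ => (1 : ℝ))) := by
  refine ⟨fun N S l hl h => ?_, fun S H l => ⟨H.eventually_posterior_eq.mono fun N hN => hN.1,
    H.tendsto_log_posterior_sub, H.log_posterior_sub_bicF_isBigO⟩⟩
  have hfid := S.logLik_eq_fidelity hl (S.est_posDef h.1)
  refine ⟨fun m => S.fim_eq_fromBlocks m h,
    fun m => ⟨S.isUnit_det_JPP h hl m, S.det_fim h hl m⟩, hfid, ?_,
    fun hJ hf hm => S.laplacePosterior_pos_and_log h hJ hf hm⟩
  rw [ClusteredData.bicF, hfid]
  simp_rw [S.det_fim h hl]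
  ring
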